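/- **Notation.** $\mathbb N=\{1,2,\dots\}$, and $[\mathbb N]^{<\omega}$ is the set of finite subsets of $\mathbb N$. For non-empty finite $s,t\subseteq\mathbb N$ write $s<t$ if $\max s<\min t$; also put $\{n\}<\emptyset$. $\mathcal B^{<\omega}(\mathbb N)$ is the set of all *finite disjoint collections* $\mathbf s=(s_1<\dots<s_k)$ of non-empty finite subsets of $\mathbb N$, including $\emptyset$; an *infinite disjoint collection* is a sequence $s_1<s_2<\cdots$ of non-empty finite subsets of $\mathbb N$. Collections are identified with the sets of their members. $FU(\cdot)$ is the set of all unions of finitely many (at least one) members of a collection, $\mathcal B^{<\omega}(\mathcal D)=\{\mathbf s\in\mathcal B^{<\omega}(\mathbb N):\mathbf s\subseteq FU(\mathcal D)\}$, and for infinite disjoint collections $\mathcal D_1<\mathcal D$ means $\mathcal D_1\subseteq FU(\mathcal D)$. All $\mathcal D,\mathcal D_1,\mathcal D_2$ below are infinite disjoint collections. $\mathbf t\propto\mathbf s$ means that $\mathbf t$ is an initial segment of $\mathbf s$. For $\mathcal F\subseteq\mathcal B^{<\omega}(\mathbb N)$ let $\mathcal F^*=\{\mathbf t\in\mathcal B^{<\omega}(\mathbb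 N):\mathbf t\propto\mathbf s\text{ for some }\mathbf s\in\mathcal F\}\cup\{\emptyset\}$; $\mathcal F$ is a *tree* if $\mathcal F^*=\mathcal F$. Its largest hereditary subfamily is $\mathcal F_h=\{\mathbf s\in\mathcal F:\text{every }\mathbf t\in\mathcal B^{<\omega}(\mathbb N)\text{ with }\mathbf t\subseteq FU(\mathbf s)\text{ belongs to }\mathcal F\}\cup\{\emptyset\}$. A family is *pointwise closed* if the set of characteristic functions of its members is closed in the product space $\{0,1\}^{[\mathbb N]^{<\omega}}$. **Schreier families.** For every countable limit ordinal $\lambda\neq0$ fix any strictly increasing sequence $(\lambda_n)_{n\ge1}$ of successor ordinals below $\lambda$ with supremum $\lambda$. Define $\mathcal A_\xi\subseteq[\mathbb N]^{<\omega}$ for $\xi<\omega_1$ recursively: $\mathcal A_0=\{\emptyset\}$; $\mathcal A_{\zeta+1}=\{\{n\}\cup s:n\in\mathbb N,\ \{n\}<s\in\mathcal A_\zeta\}$; $\mathcal A_{\omega^{\beta+1}}=\{\bigcup_{i=1}^n s_i: s_1<\dots<s_n\text{ in }\mathcal A_{\omega^\beta},\ n=\min s_1\}$; $\mathcal A_{\omega^\lambda}=\{s\neq\emptyset: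 s\in\mathcal A_{\omega^{\lambda_n}},\ n=\min s\}$ for limit $\lambda\neq0$; and if $\xi=\omega^{a_0}p_0+\dots+\omega^{a_m}p_m$ with $a_0>\dots>a_m>0$, natural numbers $p_i\ge1$, and $p_0>1$ or $m\ge1$, then $\mathcal A_\xi$ consists of all $s_m\cup\dots\cup s_1\cup s_0$ with $s_m<\dots<s_1<s_0$, each $s_i$ being the union of sets $s^i_1<\dots<s^i_{p_i}$ in $\mathcal A_{\omega^{a_i}}$. Put $\mathcal B^0=\{\emptyset\}$ and, for $1\le\xi<\omega_1$, $\mathcal B^\xi=\{(s_1<\dots<s_k)\in\mathcal B^{<\omega}(\mathbb N):k\ge1,\ \{\min s_1,\dots,\min s_k\}\in\mathcal A_\xi\}$. **Strong Cantor–Bendixson index.** For $\mathcal G\subseteq\mathcal B^{<\omega}(\mathbb N)$ let $(\mathcal G)^1_{\mathcal D}$ be the set of $\mathbf s\in\mathcal G\cap\mathcal B^{<\omega}(\mathcal D)$ for which $\{t\in FU(\mathcal D):\mathbf s\cup\{t\}\notin\mathcal G\}$ contains no infinite disjoint collection. Put $(\mathcal G)^0_{\mathcal D}=\mathcal G$,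 $(\mathcal G)_{\mathcal D}^{\zeta+1}=((\mathcal G)^\zeta_{\mathcal D})^1_{\mathcal D}$, and $(\mathcal G)^\xi_{\mathcal D}=\bigcap_{\beta<\xi}(\mathcal G)^\beta_{\mathcal D}$ for limit $\xi\neq0$. The index $s_{\mathcal D}(\mathcal G)$ is the least countable $\xi$ with $(\mathcal G)^\xi_{\mathcal D}=\emptyset$. **Theorem 3.3 (Theorem B).** Let $\mathcal F\subseteq\mathcal B^{<\omega}(\mathbb N)$ be a tree and $\mathcal D$ an infinite disjoint collection. *Case 1.* If $\mathcal F_h\cap\mathcal B^{<\omega}(\mathcal D)$ is not pointwise closed, then there is $\mathcal D_1<\mathcal D$ with $\mathcal B^{<\omega}(\mathcal D_1)\subseteq\mathcal F$. *Case 2.* If $\mathcal F_h\cap\mathcal B^{<\omega}(\mathcal D)$ is pointwise closed, then $s_{\mathcal D_1}(\mathcal F_h)$ is defined for every $\mathcal D_1<\mathcal D$, the ordinal $\zeta=\sup\{s_{\mathcal D_1}(\mathcal F_h):\mathcal D_1<\mathcal D\}$ is countable, and for every $\xi<\omega_1$: (i) if $\xi+1<\zeta$, then there is $\mathcal D_2<\mathcal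 D$ with $\mathcal B^\xi\cap\mathcal B^{<\omega}(\mathcal D_2)\subseteq\mathcal F$; (ii) if $\xi>\zeta$, then for every $\mathcal D_1<\mathcal D$ there is $\mathcal D_2<\mathcal D_1$ with $\mathcal B^\xi\cap\mathcal B^{<\omega}(\mathcal D_2)\subseteq\mathcal B^{<\omega}(\mathbb N)\setminus\mathcal F$ and (equivalently) $\mathcal F\cap\mathcal B^{<\omega}(\mathcal D_2)\subseteq(\mathcal B^\xi)^*\setminus\mathcal B^\xi$; (iii) if $\xi+1=\zeta$ or $\xi=\zeta$, then there is $\mathcal D_2<\mathcal D$ such that either $\mathcal B^\xi\cap\mathcal B^{<\omega}(\mathcal D_2)\subseteq\mathcal F$ or $\mathcal B^\xi\cap\mathcal B^{<\omega}(\mathcal D_2)\subseteq\mathcal B^{<\omega}(\mathbb N)\setminus\mathcal F$. -/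

import Mathlib

open scoped Ordinal

/-! The natural numbers of the text are `{1, 2, …}`, i.e. `ℕ+`.  A finite collection of finite sets
of natural numbers is a `Finset (Finset ℕ+)`, an infinite one a `Set (Finset ℕ+)`. -/

namespace BlockSchreier

/-- `s < t` for finite sets of natural numbers (`max s < min t` if both are nonempty). -/
def BlockLT (s t : Finset ℕ+) : Prop := ∀ a ∈ s, ∀ b ∈ t, a < b

/-- Disjoint collections (finite or infinite): the members are nonempty finite sets, and of two
different members one lies entirely before the other.  (Ordering the members by their minima, such
a collection is a finite sequence `s₁ < ⋯ < sₖ` or an infinite sequence `s₁ < s₂ < ⋯`.) -/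
def IsDisjointCollection (S : Set (Finset ℕ+)) : Prop :=
  (∀ a ∈ S, a.Nonempty) ∧ S.Pairwise (fun a b => BlockLT a b ∨ BlockLT b a)

/-- `𝓑^{<ω}(ℕ)`: all finite disjoint collections, including the empty one. -/
def finColl : Set (Finset (Finset ℕ+)) := {s | IsDisjointCollection (s : Set (Finset ℕ+))}

/-- `𝓑^ω(ℕ)`: all infinite disjoint collections. -/
def infColl : Set (Set (Finset ℕ+)) := {D | D.Infinite ∧ IsDisjointCollection D}

/-- `FU(S)`: all unions of finitely many (at least one) members of `S`. -/
def FU (S : Set (Finset ℕ+)) : Set (Finset ℕ+) :=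
  {u | ∃ T : Finset (Finset ℕ+), T.Nonempty ∧ (T : Set (Finset ℕ+)) ⊆ S ∧ u = T.biUnion id}

/-- `𝓑^{<ω}(D)`: all finite disjoint collections with members in `FU(D)`. -/
def finCollIn (D : Set (Finset ℕ+)) : Set (Finset (Finset ℕ+)) :=
  {s | s ∈ finColl ∧ (s : Set (Finset ℕ+)) ⊆ FU D}

/-- `𝓑^ω(D)`: all infinite disjoint collections `D₁` with `D₁ < D`, i.e. `D₁ ⊆ FU(D)`. -/
def infCollIn (D : Set (Finset ℕ+)) : Set (Set (Finset ℕ+)) :=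
  {D₁ | D₁ ∈ infColl ∧ D₁ ⊆ FU D}

/-- `t ∝ s`: `t` is an initial segment (possibly empty, possibly all) of `s`. -/
def IsInitial (t s : Finset (Finset ℕ+)) : Prop :=
  t ⊆ s ∧ ∀ a ∈ t, ∀ b ∈ s, b ∉ t → BlockLT a b

/-- `𝓕^*`: the initial segments of the members of `𝓕`, together with `∅`. -/
def initialClosure (F : Set (Finset (Finset ℕ+))) : Set (Finset (Finset ℕ+)) :=
  {t | t ∈ finColl ∧ ∃ s ∈ F, IsInitial t s} ∪ {∅}

/-- `𝓕` is a tree: `𝓕^* = 𝓕`. -/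
def IsTree (F : Set (Finset (Finset ℕ+))) : Prop := initialClosure F = F

/-- `𝓕_h`, the largest hereditary subfamily of `𝓕`: the members `s` of `𝓕` such that every finite
disjoint collection contained in `FU(s)` belongs to `𝓕`, together with `∅`. -/
def hereditaryPart (F : Set (Finset (Finset ℕ+))) : Set (Finset (Finset ℕ+)) :=
  {s | s ∈ F ∧ ∀ t ∈ finColl, (t : Set (Finset ℕ+)) ⊆ FU (s : Set (Finset ℕ+)) → t ∈ F} ∪ {∅}

/-- The characteristic function of a finite collection, a point of `{0,1}^{[ℕ]^{<ω}}`. -/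
def charFun (s : Finset (Finset ℕ+)) : Finset ℕ+ → Bool := fun a => decide (a ∈ s)

/-- `𝓕` is pointwise closed: its set of characteristic functions is closed in the product
topology of `{0,1}^{[ℕ]^{<ω}}`. -/
def PointwiseClosed (F : Set (Finset (Finset ℕ+))) : Prop := IsClosed (charFun '' F)

/-- A choice, for each countable limit ordinal `l ≠ 0`, of a strictly increasing sequence
`(lam l n)`, `n = 1, 2, …`, of successor ordinals smaller than `l` with supremum `l`. -/
def IsFundamentalSystem (lam : Ordinal.{0} → ℕ+ → Ordinal.{0}) : Prop :=
  ∀ l : Ordinal.{0}, Order.IsSuccLimit l → l < ω_ 1 →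
    StrictMono (lam l) ∧ (∀ n, (∃ β, lam l n = β + 1) ∧ lam l n < l) ∧
      IsLUB (Set.range (lam l)) l

/-- `Schreier lam ξ s` says that `s ∈ 𝓐_ξ`, the recursive thin Schreier system with respect to the
choice `lam` of sequences.  The premises of each clause concern strictly smaller ordinals, and
exactly one clause applies to each countable `ξ`, so this is a definition by recursion on `ξ`. -/
inductive Schreier (lam : Ordinal.{0} → ℕ+ → Ordinal.{0}) : Ordinal.{0} → Finset ℕ+ → Prop
  /-- `𝓐_0 = {∅}`. -/
  | zero : Schreier lam 0 ∅
  /-- `𝓐_{ζ+1}`: the sets `{n} ∪ s` with `{n} < s` and `s ∈ 𝓐_ζ`. -/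
  | succ (ζ : Ordinal.{0}) (n : ℕ+) (s : Finset ℕ+) (hn : BlockLT {n} s)
      (hs : Schreier lam ζ s) : Schreier lam (ζ + 1) (insert n s)
  /-- `𝓐_{ω^{β+1}}`: the unions of `s₁ < ⋯ < sₙ` in `𝓐_{ω^β}`, where `n = min s₁`. -/
  | omega_succ (β : Ordinal.{0}) (n : ℕ+) (t : Fin (n : ℕ) → Finset ℕ+)
      (hn : IsLeast (t ⟨0, n.pos⟩ : Set ℕ+) n)
      (hlt : ∀ i j, i < j → BlockLT (t i) (t j))
      (ht : ∀ i, Schreier lam (ω ^ β) (t i)) :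
      Schreier lam (ω ^ (β + 1)) (Finset.univ.biUnion t)
  /-- `𝓐_{ω^l}`, `l` a limit: the sets `s` in `𝓐_{ω^{lₙ}}`, where `n = min s`. -/
  | omega_limit (l : Ordinal.{0}) (hl : Order.IsSuccLimit l) (n : ℕ+) (s : Finset ℕ+)
      (hn : IsLeast (s : Set ℕ+) n) (hs : Schreier lam (ω ^ lam l n) s) :
      Schreier lam (ω ^ l) s
  /-- `𝓐_ξ` for `ξ = ω^{a₀} p₀ + ω^{a₁} p₁ + ⋯ + ω^{aₘ} pₘ` with `a₀ > a₁ > ⋯ > aₘ > 0`, all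
  `pᵢ ≥ 1`, and `p₀ > 1` or `m ≥ 1`: the unions of sets `sₘ < ⋯ < s₁ < s₀`, where each `sᵢ` is a
  union of `pᵢ` successive sets `t i 0 < t i 1 < ⋯` in `𝓐_{ω^{aᵢ}}`. -/
  | sum (m : ℕ) (a : Fin (m + 1) → Ordinal.{0}) (p : Fin (m + 1) → ℕ)
      (t : (i : Fin (m + 1)) → Fin (p i) → Finset ℕ+)
      (ha : StrictAnti a) (ha0 : ∀ i, 0 < a i) (hp : ∀ i, 1 ≤ p i) (hpm : 1 < p 0 ∨ 1 ≤ m)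
      (hlt : ∀ i x y, x < y → BlockLT (t i x) (t i y))
      (hlt' : ∀ i j, i < j → ∀ x y, BlockLT (t j y) (t i x))
      (ht : ∀ i x, Schreier lam (ω ^ a i) (t i x)) :
      Schreier lam (List.ofFn fun i => ω ^ a i * (p i : Ordinal.{0})).sum
        (Finset.univ.biUnion fun i => Finset.univ.biUnion (t i))

/-- `𝓑^ξ`: the finite disjoint collections `(s₁, …, sₖ)` with `{min s₁, …, min sₖ} ∈ 𝓐_ξ`.
(Since `𝓐_0 = {∅}`, and `∅ ∉ 𝓐_ξ` for `ξ ≥ 1`, this gives `𝓑^0 = {∅}` and `∅ ∉ 𝓑^ξ` for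
`ξ ≥ 1`.) -/
def blockSchreier (lam : Ordinal.{0} → ℕ+ → Ordinal.{0}) (ξ : Ordinal.{0}) :
    Set (Finset (Finset ℕ+)) :=
  {s | s ∈ finColl ∧ ∃ A : Finset ℕ+, Schreier lam ξ A ∧
    (A : Set ℕ+) = {m | ∃ a ∈ s, IsLeast (a : Set ℕ+) m}}

/-- The first strong block Cantor–Bendixson derivative of `G` on `D`. -/
def cbStep (D : Set (Finset ℕ+)) (G : Set (Finset (Finset ℕ+))) : Set (Finset (Finset ℕ+)) :=
  {s | s ∈ G ∩ finCollIn D ∧ ¬ ∃ E ∈ infColl, E ⊆ {t | t ∈ FU D ∧ s ∪ {t} ∉ G}}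

/-- The strong block Cantor–Bendixson derivatives of `G` on `D`, by transfinite iteration, with
intersections at limit stages (and stage `0` equal to `G`). -/
noncomputable def cbDeriv (D : Set (Finset ℕ+)) (G : Set (Finset (Finset ℕ+)))
    (ξ : Ordinal.{0}) : Set (Finset (Finset ℕ+)) :=
  Ordinal.limitRecOn ξ G (fun _ H => cbStep D H) (fun η _ H => ⋂ β, ⋂ h : β < η, H β h)

/-- The strong block Cantor–Bendixson index `s_D(G)`: the least countable ordinal at which the
derivative is empty. -/
noncomputable def cbIndex (D : Set (Finset ℕ+)) (G : Set (Finset (Finset ℕ+))) : Ordinal.{0} :=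
  sInf {ξ | ξ < ω_ 1 ∧ cbDeriv D G ξ = ∅}

/-- `sup {s_{D₁}(G) : D₁ < D}`. -/
noncomputable def cbSup (D : Set (Finset ℕ+)) (G : Set (Finset (Finset ℕ+))) : Ordinal.{0} :=
  sSup {η | ∃ D₁ ∈ infCollIn D, η = cbIndex D₁ G}

end BlockSchreier

/-! The Schreier families have a uniform description: choose a fundamental sequence
`fundSeq lam ξ n < ξ` for each `ξ ≠ 0`; then `𝓐_ξ` consists of the finite sets whose elements, used
one after the other as indices, lead from `ξ` down to `0`. Hence the part of `𝓑^ξ` beginning with a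
block `a` is a family of the same kind for the smaller ordinal `fundSeq lam ξ (min a)`, and a
fusion argument together with Hindman's theorem shows, by induction on `ξ`, that every family of
finite disjoint collections contains or avoids `𝓑^ξ` on some subcollection.

Which of the two happens is read off the index of `𝓗 = 𝓕_h`. The end-extension relation on `𝓗` is
well founded unless `𝓗` contains all finite collections of some `D₁ < D`, which is also what it
means for `𝓗 ∩ 𝓑^{<ω}(D)` not to be pointwise closed; well-foundedness bounds the indices. If
`𝓗` avoids `𝓑^ξ`, its derivatives disappear at least as fast as the ranks of the walks from `ξ`,
and if it contains `𝓑^ξ`, at most as fast. -/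

namespace BlockSchreier

open scoped Function

variable {lam : Ordinal.{0} → ℕ+ → Ordinal.{0}}

/-! ### Fundamental sequences -/

theorem exists_eq_opow_mul_add_one {ξ : Ordinal.{0}} (hξ : ξ ≠ 0) :
    ∃ c γ : Ordinal.{0}, ξ = ω ^ c * (γ + 1) := by
  induction ξ using Ordinal.CNF.rec ω with
  | H0 => exact absurd rfl hξ
  | H ξ _ ih =>
    set e := Ordinal.log ω ξ
    have hdecomp : ω ^ e * (ξ / ω ^ e) + ξ % ω ^ e = ξ := Ordinal.div_add_mod ξ (ω ^ e)
    by_cases hr : ξ % ω ^ e = 0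
    · obtain ⟨k, hk⟩ := Ordinal.lt_omega0.1 (Ordinal.div_opow_log_lt ξ Ordinal.one_lt_omega0)
      rw [hr, add_zero, hk] at hdecomp
      cases k with
      | zero => exact absurd hdecomp.symm (by simpa using hξ)
      | succ k => exact ⟨e, k, by rw [← Nat.cast_succ, hdecomp]⟩
    · obtain ⟨c, γ, hc⟩ := ih hr
      have hce : ω ^ c < ω ^ e := calc
        ω ^ c ≤ ξ % ω ^ e := hc ▸ le_mul_of_one_le_right' le_add_self
        _ < ω ^ e := Ordinal.mod_lt _ (Ordinal.opow_ne_zero _ Ordinal.omega0_ne_zero)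
      obtain ⟨x, hx⟩ := exists_add_of_le
        ((Ordinal.opow_lt_opow_iff_right Ordinal.one_lt_omega0).1 hce).le
      refine ⟨c, ω ^ x * (ξ / ω ^ e) + γ, ?_⟩
      rw [add_assoc, mul_add, ← mul_assoc, ← Ordinal.opow_add, ← hx, ← hc, hdecomp]

theorem opow_mul_add_one_inj {c c' γ γ' : Ordinal.{0}}
    (h : ω ^ c * (γ + 1) = ω ^ c' * (γ' + 1)) : c = c' ∧ γ = γ' := by
  have not_lt_exponent {c c' γ γ' : Ordinal.{0}}
      (h : ω ^ c * (γ + 1) = ω ^ c' * (γ' + 1)) : ¬ c < c' := by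
    intro hlt
    obtain ⟨x, rfl⟩ := exists_add_of_le hlt.le
    have hx : x ≠ 0 := by rintro rfl; simp at hlt
    rw [Ordinal.opow_add, mul_assoc] at h
    have hdvd : ω ∣ γ + 1 := by
      rw [mul_left_cancel₀ (Ordinal.opow_ne_zero c Ordinal.omega0_ne_zero) h]
      refine Dvd.dvd.mul_right ?_ _
      simpa using Ordinal.opow_dvd_opow ω (Order.one_le_iff_pos.2 (pos_iff_ne_zero.2 hx))
    exact Order.not_isSuccPrelimit_succ γ (Ordinal.isSuccPrelimit_iff_omega0_dvd.2 hdvd)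
  obtain rfl : c = c' :=
    le_antisymm (not_lt.1 (not_lt_exponent h.symm)) (not_lt.1 (not_lt_exponent h))
  have hγ := mul_left_cancel₀ (Ordinal.opow_ne_zero c Ordinal.omega0_ne_zero) h
  exact ⟨rfl, by simpa using hγ⟩

/-- The fundamental sequence of `ω ^ c` determined by `lam`, with the indexing of the Schreier
families: `A` starts with `n` and belongs to `𝓐_{ω^c}` exactly when the rest of `A` belongs to
the family of order `powFS lam c n`. It is `0` where `lam l n < l` fails. -/
noncomputable def powFS (lam : Ordinal.{0} → ℕ+ → Ordinal.{0}) (c : Ordinal.{0}) :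
    ℕ+ → Ordinal.{0} :=
  Ordinal.limitRecOn c (fun _ => 0)
    (fun b g n => ω ^ b * ((n : ℕ) - 1 : ℕ) + g n)
    (fun l _ g n => open Classical in if h : lam l n < l then g (lam l n) h n else 0)

theorem powFS_zero (n : ℕ+) : powFS lam 0 n = 0 := by
  simp [powFS]

theorem powFS_add_one (b : Ordinal.{0}) (n : ℕ+) :
    powFS lam (b + 1) n = ω ^ b * ((n : ℕ) - 1 : ℕ) + powFS lam b n := by
  simp [powFS]

theorem powFS_limit {l : Ordinal.{0}} (hl : Order.IsSuccLimit l) {n : ℕ+} (h : lam l n < l) :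
    powFS lam l n = powFS lam (lam l n) n := by
  simp only [powFS]
  rw [Ordinal.limitRecOn_limit _ _ _ _ hl, dif_pos h]

theorem powFS_lt (c : Ordinal.{0}) (n : ℕ+) : powFS lam c n < ω ^ c := by
  induction c using Ordinal.limitRecOn with
  | zero => simp [powFS_zero]
  | add_one b ih =>
    have hn : (((n : ℕ) - 1 : ℕ) : Ordinal.{0}) + 1 = (n : ℕ) := by
      exact_mod_cast Nat.sub_add_cancel n.pos
    calc powFS lam (b + 1) n
        = ω ^ b * ((n : ℕ) - 1 : ℕ) + powFS lam b n := powFS_add_one b n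
      _ < ω ^ b * ((n : ℕ) - 1 : ℕ) + ω ^ b := by gcongr
      _ = ω ^ b * (n : ℕ) := by rw [← hn, mul_add, mul_one]
      _ < ω ^ (b + 1) := Ordinal.opow_mul_lt_opow (Ordinal.natCast_lt_omega0 _) (lt_add_one b)
  | limit l hl ih =>
    by_cases h : lam l n < l
    · rw [powFS_limit hl h]
      exact (ih _ h).trans ((Ordinal.opow_lt_opow_iff_right Ordinal.one_lt_omega0).2 h)
    · simp only [powFS]
      rw [Ordinal.limitRecOn_limit _ _ _ _ hl, dif_neg h]
      exact Ordinal.opow_pos _ Ordinal.omega0_pos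

theorem eventually_le_powFS (hlam : IsFundamentalSystem lam) {c η : Ordinal.{0}} (hc : c < ω_ 1)
    (hη : η < ω ^ c) : ∀ᶠ n in Filter.atTop, η ≤ powFS lam c n := by
  rcases Ordinal.zero_or_succ_or_isSuccLimit c with rfl | ⟨b, rfl⟩ | hl
  · simp_all
  · obtain ⟨k, hk⟩ := Ordinal.lt_omega0_opow_succ.1 hη
    filter_upwards [Filter.eventually_ge_atTop k.succPNat] with n hn
    have hkn : k ≤ (n : ℕ) - 1 := by
      have : k + 1 ≤ (n : ℕ) := hn
      omega
    calc η ≤ ω ^ b * k := hk.le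
      _ ≤ ω ^ b * ((n : ℕ) - 1 : ℕ) := by gcongr
      _ ≤ powFS lam (Order.succ b) n := by
        rw [Order.succ_eq_add_one, powFS_add_one]
        exact le_self_add
  · obtain ⟨μ, hμ, hημ⟩ := (Ordinal.lt_opow_of_isSuccLimit Ordinal.omega0_ne_zero hl).1 hη
    obtain ⟨hmono, hsucc, hlub⟩ := hlam c hl hc
    obtain ⟨_, ⟨N, rfl⟩, hN⟩ := (lt_isLUB_iff hlub).1 hμ
    filter_upwards [Filter.eventually_ge_atTop N, Filter.eventually_ge_atTop 2] with n hn hn2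
    obtain ⟨⟨γ, hγ⟩, hlt⟩ := hsucc n
    have hμγ : μ ≤ γ := by
      rw [← Order.lt_add_one_iff, ← hγ]
      exact hN.trans_le (hmono.monotone hn)
    have hone : 1 ≤ (n : ℕ) - 1 := by
      have : 2 ≤ (n : ℕ) := hn2
      omega
    calc η ≤ ω ^ μ * (1 : ℕ) := by simpa using hημ.le
      _ ≤ ω ^ γ * ((n : ℕ) - 1 : ℕ) := by
        gcongr
        exact Ordinal.omega0_pos
      _ ≤ powFS lam c n := by
        rw [powFS_limit hl hlt, hγ, powFS_add_one]
        exact le_self_add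

/-- The fundamental sequence of `ξ = ω ^ c * (γ + 1)`, namely `ω ^ c * γ + powFS lam c n`; for a
successor it is constantly the predecessor. The value at `0` is `0`. -/
noncomputable def fundSeq (lam : Ordinal.{0} → ℕ+ → Ordinal.{0}) (ξ : Ordinal.{0}) (n : ℕ+) :
    Ordinal.{0} :=
  open Classical in
  if h : ∃ x : Ordinal.{0} × Ordinal.{0}, ω ^ x.1 * (x.2 + 1) = ξ then
    ω ^ h.choose.1 * h.choose.2 + powFS lam h.choose.1 n
  else 0

theorem fundSeq_opow_mul_add_one (c γ : Ordinal.{0}) (n : ℕ+) :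
    fundSeq lam (ω ^ c * (γ + 1)) n = ω ^ c * γ + powFS lam c n := by
  have h : ∃ x : Ordinal.{0} × Ordinal.{0}, ω ^ x.1 * (x.2 + 1) = ω ^ c * (γ + 1) :=
    ⟨(c, γ), rfl⟩
  obtain ⟨hc, hγ⟩ := opow_mul_add_one_inj h.choose_spec
  rw [fundSeq, dif_pos h, hc, hγ]

theorem fundSeq_opow (c : Ordinal.{0}) (n : ℕ+) : fundSeq lam (ω ^ c) n = powFS lam c n := by
  simpa using fundSeq_opow_mul_add_one (lam := lam) c 0 n

theorem fundSeq_add_one (ζ : Ordinal.{0}) (n : ℕ+) : fundSeq lam (ζ + 1) n = ζ := by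
  simpa [powFS_zero] using fundSeq_opow_mul_add_one (lam := lam) 0 ζ n

theorem fundSeq_lt {ξ : Ordinal.{0}} (hξ : ξ ≠ 0) (n : ℕ+) : fundSeq lam ξ n < ξ := by
  obtain ⟨c, γ, rfl⟩ := exists_eq_opow_mul_add_one hξ
  rw [fundSeq_opow_mul_add_one, mul_add, mul_one]
  gcongr
  exact powFS_lt c n

theorem fundSeq_add {α β c : Ordinal.{0}} (hβ0 : β ≠ 0) (hβ : β ≤ ω ^ c) (hα : ω ^ c ∣ α)
    (n : ℕ+) : fundSeq lam (α + β) n = α + fundSeq lam β n := by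
  obtain ⟨b, γ, rfl⟩ := exists_eq_opow_mul_add_one hβ0
  have hbc : b ≤ c := by
    rw [← Ordinal.opow_le_opow_iff_right Ordinal.one_lt_omega0]
    exact (le_mul_of_one_le_right' le_add_self).trans hβ
  obtain ⟨δ, rfl⟩ := (Ordinal.opow_dvd_opow ω hbc).trans hα
  rw [← mul_add, ← add_assoc, fundSeq_opow_mul_add_one, fundSeq_opow_mul_add_one, mul_add,
    add_assoc]

theorem eventually_le_fundSeq (hlam : IsFundamentalSystem lam) {ξ η : Ordinal.{0}}
    (hξ : ξ < ω_ 1) (hη : η < ξ) : ∀ᶠ n in Filter.atTop, η ≤ fundSeq lam ξ n := by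
  obtain ⟨c, γ, rfl⟩ := exists_eq_opow_mul_add_one (pos_of_gt hη).ne'
  have hc : c < ω_ 1 := calc
    c ≤ ω ^ c := Ordinal.right_le_opow c Ordinal.one_lt_omega0
    _ ≤ ω ^ c * (γ + 1) := le_mul_of_one_le_right' le_add_self
    _ < ω_ 1 := hξ
  have hsub : η - ω ^ c * γ < ω ^ c := by
    refine Ordinal.sub_lt_of_lt_add ?_ (Ordinal.opow_pos _ Ordinal.omega0_pos)
    rwa [mul_add, mul_one] at hη
  filter_upwards [eventually_le_powFS hlam hc hsub] with n hn
  rw [fundSeq_opow_mul_add_one]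
  exact Ordinal.sub_le.1 hn

/-! ### Walks along fundamental sequences -/

/-- `A` is a finite initial segment of the set `X`. -/
def IsInitSeg {α : Type*} [LT α] (A : Finset α) (X : Set α) : Prop :=
  (A : Set α) ⊆ X ∧ ∀ x ∈ A, ∀ y ∈ X, y ∉ A → x < y

theorem insert_eq_insert_of_lt {α : Type*} [LinearOrder α] {A B : Finset α} {n k : α}
    (hA : ∀ x ∈ A, x < n) (hB : ∀ x ∈ B, x < k) (h : insert n A = insert k B) :
    n = k ∧ A = B := by
  have hnk : n = k := by
    rcases Finset.mem_insert.1 (h ▸ Finset.mem_insert_self n A) with hn | hn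
    · exact hn
    · rcases Finset.mem_insert.1 (h ▸ Finset.mem_insert_self k B) with hk | hk
      · exact hk.symm
      · exact absurd (hA k hk) (hB n hn).asymm
  subst hnk
  refine ⟨rfl, ?_⟩
  rw [← Finset.erase_insert (fun hn => (hA n hn).false), h,
    Finset.erase_insert (fun hn => (hB n hn).false)]

/-- `Reach lam ξ A ρ`: starting from `ξ` and passing to `fundSeq lam · n` for the successive
elements `n` of `A`, all these ordinals being nonzero, one arrives at `ρ`. The Schreier family
`𝓐_ξ` consists of the sets leading from `ξ` to `0`. -/
inductive Reach (lam : Ordinal.{0} → ℕ+ → Ordinal.{0}) (ξ : Ordinal.{0}) :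
    Finset ℕ+ → Ordinal.{0} → Prop
  | nil : Reach lam ξ ∅ ξ
  | snoc {A : Finset ℕ+} {ρ : Ordinal.{0}} {n : ℕ+} (h : Reach lam ξ A ρ) (hρ : ρ ≠ 0)
      (hn : ∀ x ∈ A, x < n) : Reach lam ξ (insert n A) (fundSeq lam ρ n)

namespace Reach

variable {ξ ρ : Ordinal.{0}} {A B : Finset ℕ+} {n : ℕ+}

theorem of_empty (h : Reach lam ξ ∅ ρ) : ρ = ξ := by
  generalize hE : (∅ : Finset ℕ+) = E at h
  cases h with
  | nil => rfl
  | snoc => exact absurd hE.symm (Finset.insert_ne_empty _ _)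

theorem last (h : Reach lam ξ (insert n A) ρ) (hA : ∀ x ∈ A, x < n) :
    ∃ σ, Reach lam ξ A σ ∧ σ ≠ 0 ∧ ρ = fundSeq lam σ n := by
  generalize hE : insert n A = E at h
  cases h with
  | nil => exact absurd hE (Finset.insert_ne_empty _ _)
  | snoc h hρ hn =>
    obtain ⟨rfl, rfl⟩ := insert_eq_insert_of_lt hA hn hE
    exact ⟨_, h, hρ, rfl⟩

theorem unique {σ : Ordinal.{0}} (h : Reach lam ξ A ρ) (h' : Reach lam ξ A σ) : ρ = σ := by
  induction h generalizing σ with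
  | nil => exact h'.of_empty.symm
  | snoc _ _ hn ih =>
    obtain ⟨τ, hτ, _, rfl⟩ := h'.last hn
    rw [ih hτ]

theorem le (h : Reach lam ξ A ρ) : ρ ≤ ξ := by
  induction h with
  | nil => exact le_rfl
  | snoc _ hρ _ ih => exact (fundSeq_lt hρ _).le.trans ih

theorem trans {σ : Ordinal.{0}} (h : Reach lam ξ A ρ) (h' : Reach lam ρ B σ)
    (hAB : BlockLT A B) : Reach lam ξ (A ∪ B) σ := by
  induction h' with
  | nil => simpa using h
  | @snoc B σ n _ hσ hn ih =>
    rw [Finset.union_insert]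
    refine snoc (ih fun a ha b hb => hAB a ha b (Finset.mem_insert_of_mem hb)) hσ fun x hx => ?_
    rcases Finset.mem_union.1 hx with hx | hx
    · exact hAB x hx n (Finset.mem_insert_self _ _)
    · exact hn x hx

theorem cons (hξ : ξ ≠ 0) (h : Reach lam (fundSeq lam ξ n) A ρ) (hn : ∀ x ∈ A, n < x) :
    Reach lam ξ (insert n A) ρ := by
  have hstep : Reach lam ξ {n} (fundSeq lam ξ n) := snoc (A := ∅) nil hξ (by simp)
  rw [Finset.insert_eq]
  exact hstep.trans h (by simpa [BlockLT] using hn)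

theorem first (h : Reach lam ξ (insert n A) ρ) (hn : ∀ x ∈ A, n < x) :
    ξ ≠ 0 ∧ Reach lam (fundSeq lam ξ n) A ρ := by
  induction A using Finset.induction_on_max generalizing ρ with
  | empty =>
    obtain ⟨σ, hσ, hσ0, rfl⟩ := h.last (by simp)
    obtain rfl := hσ.of_empty
    exact ⟨hσ0, nil⟩
  | insert k A hk ih =>
    rw [Finset.insert_comm] at h
    have hmax : ∀ x ∈ insert n A, x < k := fun x hx => by
      rcases Finset.mem_insert.1 hx with rfl | hx
      · exact hn k (Finset.mem_insert_self _ _)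
      · exact hk x hx
    obtain ⟨σ, hσ, hσ0, rfl⟩ := h.last hmax
    obtain ⟨hξ, hA⟩ := ih hσ fun x hx => hn x (Finset.mem_insert_of_mem hx)
    exact ⟨hξ, snoc hA hσ0 hk⟩

theorem exists_first (h : Reach lam ξ A ρ) (hA : IsLeast (A : Set ℕ+) n) :
    ∃ B, A = insert n B ∧ (∀ x ∈ B, n < x) ∧ ξ ≠ 0 ∧ Reach lam (fundSeq lam ξ n) B ρ := by
  have hA' : A = insert n (A.erase n) := (Finset.insert_erase hA.1).symm
  have hn : ∀ x ∈ A.erase n, n < x := fun x hx =>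
    lt_of_le_of_ne (hA.2 (Finset.mem_of_mem_erase hx)) (Finset.ne_of_mem_erase hx).symm
  exact ⟨_, hA', hn, first (hA' ▸ h) hn⟩

theorem add_left {α c : Ordinal.{0}} (h : Reach lam ξ A ρ) (hξ : ξ ≤ ω ^ c) (hα : ω ^ c ∣ α) :
    Reach lam (α + ξ) A (α + ρ) := by
  induction h with
  | nil => exact nil
  | snoc h hρ hn ih =>
    rw [← fundSeq_add hρ (h.le.trans hξ) hα]
    exact snoc ih (by simp [hρ]) hn

theorem eq_of_isInitSeg (hA : Reach lam ξ A 0) (hB : Reach lam ξ B ρ)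
    (hAB : IsInitSeg A (B : Set ℕ+)) : A = B := by
  induction hB with
  | nil => exact Finset.subset_empty.1 (Finset.coe_subset.1 hAB.1)
  | @snoc B ρ n h hρ hn ih =>
    obtain ⟨hsub, hlt⟩ := hAB
    by_cases hnA : n ∈ A
    · refine Finset.Subset.antisymm (Finset.coe_subset.1 hsub) fun y hy => ?_
      by_contra hyA
      have hny := hlt n hnA y hy hyA
      rcases Finset.mem_insert.1 hy with rfl | hy
      · exact hny.false
      · exact hny.asymm (hn y hy)
    · have hAB : (A : Set ℕ+) ⊆ B := fun x hx =>
        (Finset.mem_insert.1 (hsub hx)).resolve_left fun hxn => hnA (hxn ▸ hx)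
      obtain rfl := ih ⟨hAB, fun x hx y hy => hlt x hx y (Finset.mem_insert_of_mem hy)⟩
      exact absurd (h.unique hA) hρ

end Reach

/-! ### The Schreier families are the families of terminating walks -/

theorem reach_opow_mul_natCast {β : Ordinal.{0}} {k : ℕ} (t : Fin k → Finset ℕ+)
    (hlt : ∀ i j, i < j → BlockLT (t i) (t j)) (ht : ∀ i, Reach lam (ω ^ β) (t i) 0) :
    Reach lam (ω ^ β * (k : Ordinal.{0})) (Finset.univ.biUnion t) 0 := by
  induction k with
  | zero => simpa using Reach.nil
  | succ k ih =>
    have hhead : Reach lam (ω ^ β * ((k + 1 : ℕ) : Ordinal.{0})) (t 0) (ω ^ β * k) := by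
      simpa [mul_add_one] using (ht 0).add_left le_rfl (Dvd.intro (k : Ordinal.{0}) rfl)
    have htail := ih (fun i => t i.succ) (fun i j hij => hlt _ _ (Fin.succ_lt_succ_iff.2 hij))
      fun i => ht _
    have hunion : Finset.univ.biUnion t = t 0 ∪ Finset.univ.biUnion fun i : Fin k => t i.succ := by
      ext x; simp [Fin.exists_fin_succ]
    rw [hunion]
    refine hhead.trans htail fun a ha b hb => ?_
    obtain ⟨i, -, hi⟩ := Finset.mem_biUnion.1 hb
    exact hlt 0 i.succ (Fin.succ_pos i) a ha b hi

theorem reach_opow_add_one {β : Ordinal.{0}} {k : ℕ} (t : Fin (k + 1) → Finset ℕ+)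
    (hk : IsLeast (t 0 : Set ℕ+) k.succPNat) (hlt : ∀ i j, i < j → BlockLT (t i) (t j))
    (ht : ∀ i, Reach lam (ω ^ β) (t i) 0) :
    Reach lam (ω ^ (β + 1)) (Finset.univ.biUnion t) 0 := by
  obtain ⟨B, hB, hkB, -, hR⟩ := (ht 0).exists_first hk
  have hhead : Reach lam (ω ^ (β + 1)) (t 0) (ω ^ β * k) := by
    rw [hB]
    refine Reach.cons (Ordinal.opow_ne_zero _ Ordinal.omega0_ne_zero) ?_ hkB
    rw [fundSeq_opow] at hR
    rw [fundSeq_opow, powFS_add_one]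
    simpa using hR.add_left (powFS_lt β _).le (Dvd.intro (k : Ordinal.{0}) rfl)
  have htail := reach_opow_mul_natCast (fun i : Fin k => t i.succ)
    (fun i j hij => hlt _ _ (Fin.succ_lt_succ_iff.2 hij)) fun i => ht _
  have hunion : Finset.univ.biUnion t = t 0 ∪ Finset.univ.biUnion fun i : Fin k => t i.succ := by
    ext x; simp [Fin.exists_fin_succ]
  rw [hunion]
  refine hhead.trans htail fun a ha b hb => ?_
  obtain ⟨i, -, hi⟩ := Finset.mem_biUnion.1 hb
  exact hlt 0 i.succ (Fin.succ_pos i) a ha b hi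

theorem sum_opow_lt {m : ℕ} (a : Fin m → Ordinal.{0}) (p : Fin m → ℕ) {e : Ordinal.{0}}
    (he : ∀ i, a i < e) : (List.ofFn fun i => ω ^ a i * (p i : Ordinal.{0})).sum < ω ^ e := by
  induction m with
  | zero => simpa using Ordinal.opow_pos e Ordinal.omega0_pos
  | succ m ih =>
    rw [List.ofFn_succ, List.sum_cons]
    exact Ordinal.isPrincipal_add_omega0_opow e
      (Ordinal.opow_mul_lt_opow (Ordinal.natCast_lt_omega0 _) (he 0))
      (ih (fun i => a i.succ) (fun i => p i.succ) fun i => he _)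

theorem opow_le_sum_opow {m : ℕ} (a : Fin m → Ordinal.{0}) (p : Fin m → ℕ) {i : Fin m}
    (hp : 1 ≤ p i) : ω ^ a i ≤ (List.ofFn fun i => ω ^ a i * (p i : Ordinal.{0})).sum := calc
  ω ^ a i ≤ ω ^ a i * (p i : Ordinal.{0}) := le_mul_of_one_le_right' (by exact_mod_cast hp)
  _ ≤ (List.ofFn fun i => ω ^ a i * (p i : Ordinal.{0})).sum :=
    List.le_sum_of_mem (List.mem_ofFn.2 ⟨i, rfl⟩)

theorem reach_sum {m : ℕ} (a : Fin m → Ordinal.{0}) (p : Fin m → ℕ)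
    (t : (i : Fin m) → Fin (p i) → Finset ℕ+) (ha : StrictAnti a)
    (hlt : ∀ i x y, x < y → BlockLT (t i x) (t i y))
    (hlt' : ∀ i j, i < j → ∀ x y, BlockLT (t j y) (t i x))
    (ht : ∀ i x, Reach lam (ω ^ a i) (t i x) 0) :
    Reach lam (List.ofFn fun i => ω ^ a i * (p i : Ordinal.{0})).sum
      (Finset.univ.biUnion fun i => Finset.univ.biUnion (t i)) 0 := by
  induction m with
  | zero => simpa using Reach.nil
  | succ m ih =>
    have hlower := (ih (fun i => a i.succ) (fun i => p i.succ) (fun i => t i.succ)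
      (fun i j hij => ha (Fin.succ_lt_succ_iff.2 hij)) (fun i => hlt _)
      (fun i j hij => hlt' _ _ (Fin.succ_lt_succ_iff.2 hij)) fun i => ht _).add_left
        (sum_opow_lt _ _ fun i => ha (Fin.succ_pos i)).le (Dvd.intro (p 0 : Ordinal.{0}) rfl)
    rw [add_zero] at hlower
    have htop := reach_opow_mul_natCast (t 0) (hlt 0) (ht 0)
    have hunion : (Finset.univ.biUnion fun i => Finset.univ.biUnion (t i)) =
        (Finset.univ.biUnion fun i : Fin m => Finset.univ.biUnion (t i.succ)) ∪
          Finset.univ.biUnion (t 0) := by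
      ext x; simp [Fin.exists_fin_succ, or_comm]
    rw [List.ofFn_succ, List.sum_cons, hunion]
    refine hlower.trans htop fun x hx y hy => ?_
    simp only [Finset.mem_biUnion, Finset.mem_univ, true_and] at hx hy
    obtain ⟨i, u, hx⟩ := hx
    obtain ⟨v, hy⟩ := hy
    exact hlt' 0 i.succ (Fin.succ_pos i) v u x hx y hy

theorem Schreier.reach (hlam : IsFundamentalSystem lam) {ξ : Ordinal.{0}} {A : Finset ℕ+}
    (h : Schreier lam ξ A) (hξ : ξ < ω_ 1) : Reach lam ξ A 0 := by
  induction h with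
  | zero => exact Reach.nil
  | succ ζ n s hn _ ih =>
    refine Reach.cons (by simp) ?_ (hn n (Finset.mem_singleton_self n))
    rw [fundSeq_add_one]
    exact ih ((lt_add_one ζ).trans hξ)
  | omega_succ β n t hn hlt ht ih =>
    have hβ : ω ^ β < ω ^ (β + 1) :=
      (Ordinal.opow_lt_opow_iff_right Ordinal.one_lt_omega0).2 (lt_add_one β)
    obtain ⟨k, rfl⟩ : ∃ k : ℕ, n = k.succPNat := ⟨n.natPred, (PNat.succPNat_natPred n).symm⟩
    exact reach_opow_add_one t hn hlt fun i => ih i (hβ.trans hξ)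
  | omega_limit l hl n s hn hs ih =>
    have hl' : l < ω_ 1 := (Ordinal.right_le_opow l Ordinal.one_lt_omega0).trans_lt hξ
    have hlt : lam l n < l := ((hlam l hl hl').2.1 n).2
    have hreach := ih (((Ordinal.opow_lt_opow_iff_right Ordinal.one_lt_omega0).2 hlt).trans hξ)
    obtain ⟨B, rfl, hB, -, hR⟩ := hreach.exists_first hn
    refine Reach.cons (Ordinal.opow_ne_zero _ Ordinal.omega0_ne_zero) ?_ hB
    rwa [fundSeq_opow, powFS_limit hl hlt, ← fundSeq_opow]
  | sum m a p t ha _ hp _ hlt hlt' _ ih =>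
    exact reach_sum a p t ha hlt hlt' fun i x =>
      ih i x ((opow_le_sum_opow a p (hp i)).trans_lt hξ)

theorem IsInitSeg.union {α : Type*} [LT α] [DecidableEq α] {A B : Finset α} {X : Set α}
    (hA : IsInitSeg A X) (hB : IsInitSeg B (X \ A)) : IsInitSeg (A ∪ B) X := by
  refine ⟨?_, fun x hx y hy hyn => ?_⟩
  · rw [Finset.coe_union]
    exact Set.union_subset hA.1 (hB.1.trans Set.sdiff_subset)
  · rw [Finset.mem_union, not_or] at hyn
    rcases Finset.mem_union.1 hx with hx | hx
    · exact hA.2 x hx y hy hyn.1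
    · exact hB.2 x hx y ⟨hy, hyn.1⟩ hyn.2

theorem IsInitSeg.isLeast {α : Type*} [Preorder α] {A : Finset α} {X : Set α} {n : α}
    (hA : IsInitSeg A X) (hne : A.Nonempty) (hn : IsLeast X n) : IsLeast (A : Set α) n := by
  refine ⟨?_, fun x hx => hn.2 (hA.1 hx)⟩
  obtain ⟨x, hx⟩ := hne
  by_contra h
  exact (hA.2 x hx n hn.1 h).not_ge (hn.2 (hA.1 hx))

theorem exists_isLeast {α : Type*} [LinearOrder α] [WellFoundedLT α] {X : Set α}
    (hX : X.Nonempty) : ∃ n, IsLeast X n :=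
  ⟨_, WellFounded.min_mem wellFounded_lt X hX, fun _ hx => WellFounded.min_le wellFounded_lt hx⟩

theorem exists_isInitSeg_biUnion {ι : Type*} [LinearOrder ι] [Fintype ι]
    {P : ι → Finset ℕ+ → Prop} (hP : ∀ i, ∀ X : Set ℕ+, X.Infinite → ∃ A, IsInitSeg A X ∧ P i A)
    {X : Set ℕ+} (hX : X.Infinite) :
    ∃ t : ι → Finset ℕ+, (∀ i, P i (t i)) ∧ (∀ i j, i < j → BlockLT (t i) (t j)) ∧
      IsInitSeg (Finset.univ.biUnion t) X := by
  choose! A hA hPA using hP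
  let t : ι → Finset ℕ+ := WellFoundedLT.fix fun i t => A i (X \ {x | ∃ j, ∃ h : j < i, x ∈ t j h})
  let rest (i : ι) : Set ℕ+ := X \ {x | ∃ j < i, x ∈ t j}
  have ht (i : ι) : t i = A i (rest i) := by
    simp only [t, rest, ← exists_prop]
    exact WellFoundedLT.fix_eq _ i
  have hrest (i : ι) : (rest i).Infinite := by
    refine hX.sdiff (((Finset.univ.biUnion t).finite_toSet).subset ?_)
    rintro x ⟨j, -, hx⟩
    exact Finset.mem_biUnion.2 ⟨j, Finset.mem_univ j, hx⟩
  have hinit (i : ι) : IsInitSeg (t i) (rest i) := ht i ▸ hA i _ (hrest i)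
  refine ⟨t, fun i => ht i ▸ hPA i _ (hrest i), fun i j hij a ha b hb => ?_, fun x hx => ?_,
    fun x hx y hy hyt => ?_⟩
  · obtain ⟨hbX, hbt⟩ := (hinit j).1 hb
    exact (hinit i).2 a ha b ⟨hbX, fun ⟨k, hk, hbk⟩ => hbt ⟨k, hk.trans hij, hbk⟩⟩
      fun hbi => hbt ⟨i, hij, hbi⟩
  · obtain ⟨i, -, hi⟩ := Finset.mem_biUnion.1 hx
    exact ((hinit i).1 hi).1
  · have hyt' (j : ι) : y ∉ t j := fun h =>
      hyt (Finset.mem_biUnion.2 ⟨j, Finset.mem_univ j, h⟩)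
    obtain ⟨i, -, hi⟩ := Finset.mem_biUnion.1 hx
    exact (hinit i).2 x hi y ⟨hy, fun ⟨j, _, h⟩ => hyt' j h⟩ (hyt' i)

theorem fst_pos_of_mem_CNF {ξ : Ordinal.{0}} (hω : ω ∣ ξ) {x : Ordinal.{0} × Ordinal.{0}}
    (hx : x ∈ Ordinal.CNF ω ξ) : 0 < x.1 := by
  induction ξ using Ordinal.CNF.rec ω with
  | H0 => simp at hx
  | H ξ hξ ih =>
    have hlog : 0 < Ordinal.log ω ξ :=
      Ordinal.log_pos Ordinal.one_lt_omega0 hξ (Ordinal.le_of_dvd hξ hω)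
    rw [Ordinal.CNF.ne_zero hξ, List.mem_cons] at hx
    rcases hx with rfl | hx
    · exact hlog
    · refine ih ?_ hx
      have hdvd : ω ∣ ω ^ Ordinal.log ω ξ * (ξ / ω ^ Ordinal.log ω ξ) := by
        refine Dvd.dvd.mul_right ?_ _
        simpa using Ordinal.opow_dvd_opow ω (Order.one_le_iff_pos.2 hlog)
      rwa [← Ordinal.dvd_add_iff hdvd, Ordinal.div_add_mod]

theorem exists_eq_sum_opow {ξ : Ordinal.{0}} (hξ : ξ ≠ 0) (hω : ω ∣ ξ) :
    ∃ (m : ℕ) (a : Fin (m + 1) → Ordinal.{0}) (p : Fin (m + 1) → ℕ), StrictAnti a ∧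
      (∀ i, 0 < a i) ∧ (∀ i, 1 ≤ p i) ∧
      ξ = (List.ofFn fun i => ω ^ a i * (p i : Ordinal.{0})).sum := by
  obtain ⟨n, f, hf⟩ : ∃ (n : ℕ) (f : Fin n → Ordinal.{0} × Ordinal.{0}),
    Ordinal.CNF ω ξ = List.ofFn f := ⟨_, _, (List.ofFn_get _).symm⟩
  have hmem (i : Fin n) : f i ∈ Ordinal.CNF ω ξ := hf ▸ List.mem_ofFn.2 ⟨i, rfl⟩
  choose p hp using fun i => Ordinal.lt_omega0.1
    (Ordinal.CNF.snd_lt Ordinal.one_lt_omega0 (hmem i))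
  cases n with
  | zero => simp [Ordinal.CNF.ne_zero hξ] at hf
  | succ m =>
    refine ⟨m, fun i => (f i).1, p, ?_, fun i => fst_pos_of_mem_CNF hω (hmem i), fun i => ?_, ?_⟩
    · have hsorted := Ordinal.CNF.sortedGT ω ξ
      rw [hf, List.map_ofFn, List.sortedGT_ofFn_iff] at hsorted
      exact hsorted
    · have hpos := Ordinal.CNF.snd_pos (hmem i)
      rw [hp i] at hpos
      exact_mod_cast hpos
    · have hmap : (List.ofFn fun i => ω ^ (f i).1 * (p i : Ordinal.{0})) =
          (Ordinal.CNF ω ξ).map fun x => ω ^ x.1 * x.2 := by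
        simp [hf, List.map_ofFn, Function.comp_def, hp]
      rw [hmap, List.sum, List.foldr_map, Ordinal.CNF.foldr]

theorem exists_schreier_add_one {ζ : Ordinal.{0}}
    (h : ∀ X : Set ℕ+, X.Infinite → ∃ A, IsInitSeg A X ∧ Schreier lam ζ A)
    {X : Set ℕ+} (hX : X.Infinite) : ∃ A, IsInitSeg A X ∧ Schreier lam (ζ + 1) A := by
  obtain ⟨n, hn⟩ := exists_isLeast hX.nonempty
  obtain ⟨A, hA, hS⟩ := h (X \ ({n} : Finset ℕ+)) (hX.sdiff (Finset.finite_toSet _))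
  have hn' : IsInitSeg {n} X := by
    refine ⟨by simpa using hn.1, fun x hx y hy hyn => ?_⟩
    rw [Finset.mem_singleton] at hx hyn
    exact hx ▸ lt_of_le_of_ne (hn.2 hy) (Ne.symm hyn)
  exact ⟨insert n A, Finset.insert_eq n A ▸ hn'.union hA, .succ ζ n A
    (fun x hx y hy => hn'.2 x hx y (hA.1 hy).1 (hA.1 hy).2) hS⟩

theorem exists_schreier_opow_add_one {b : Ordinal.{0}}
    (h : ∀ X : Set ℕ+, X.Infinite → ∃ A, IsInitSeg A X ∧ Schreier lam (ω ^ b) A ∧ A.Nonempty)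
    {X : Set ℕ+} (hX : X.Infinite) : ∃ A, IsInitSeg A X ∧ Schreier lam (ω ^ (b + 1)) A := by
  obtain ⟨n, hn⟩ := exists_isLeast hX.nonempty
  obtain ⟨t, ht, hlt, hinit⟩ := exists_isInitSeg_biUnion (fun _ : Fin n => h) hX
  refine ⟨_, hinit, .omega_succ b n t ?_ hlt fun i => (ht i).1⟩
  have hle (i : Fin n) (x : ℕ+) (hx : x ∈ t i) : n ≤ x :=
    hn.2 (hinit.1 (Finset.mem_biUnion.2 ⟨i, Finset.mem_univ _, hx⟩))
  obtain ⟨x, hx⟩ := (ht ⟨0, n.pos⟩).2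
  have hmem := (hinit.isLeast ⟨x, Finset.mem_biUnion.2 ⟨_, Finset.mem_univ _, hx⟩⟩ hn).1
  obtain ⟨i, -, hi⟩ := Finset.mem_biUnion.1 (Finset.mem_coe.1 hmem)
  have hi0 : ⟨0, n.pos⟩ = i := by
    refine eq_of_le_of_not_lt (Fin.mk_le_of_le_val (Nat.zero_le _)) fun h0 => ?_
    exact (hlt _ _ h0 x hx n hi).not_ge (hle _ x hx)
  exact ⟨hi0 ▸ hi, hle _⟩

theorem Schreier.nonempty (hlam : IsFundamentalSystem lam) {ξ : Ordinal.{0}} {A : Finset ℕ+}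
    (h : Schreier lam ξ A) (hξ : ξ < ω_ 1) (hξ0 : ξ ≠ 0) : A.Nonempty := by
  rw [Finset.nonempty_iff_ne_empty]
  rintro rfl
  exact hξ0 (h.reach hlam hξ).of_empty.symm

theorem exists_schreier_opow (hlam : IsFundamentalSystem lam) {c : Ordinal.{0}} (hc : c < ω_ 1)
    {X : Set ℕ+} (hX : X.Infinite) : ∃ A, IsInitSeg A X ∧ Schreier lam (ω ^ c) A := by
  induction c using WellFoundedLT.induction generalizing X with
  | ind c ih =>
  have ih' (b : Ordinal.{0}) (hbc : b < c) (X : Set ℕ+) (hX : X.Infinite) :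
      ∃ A, IsInitSeg A X ∧ Schreier lam (ω ^ b) A ∧ A.Nonempty := by
    obtain ⟨A, hA, hS⟩ := ih b hbc (hbc.trans hc) hX
    exact ⟨A, hA, hS, hS.nonempty hlam
      (Ordinal.isPrincipal_opow_omega 1 Ordinal.omega0_lt_omega_one (hbc.trans hc))
      (Ordinal.opow_ne_zero b Ordinal.omega0_ne_zero)⟩
  rcases Ordinal.zero_or_succ_or_isSuccLimit c with rfl | ⟨b, rfl⟩ | hl
  · have := exists_schreier_add_one (lam := lam) (ζ := 0)
      (fun X _ => ⟨∅, by simp [IsInitSeg], .zero⟩) hX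
    simpa using this
  · exact exists_schreier_opow_add_one (ih' b (Order.lt_succ b)) hX
  · obtain ⟨n, hn⟩ := exists_isLeast hX.nonempty
    obtain ⟨A, hA, hS, hne⟩ := ih' _ ((hlam c hl hc).2.1 n).2 X hX
    exact ⟨A, hA, .omega_limit c hl n A (hA.isLeast hne hn) hS⟩

theorem exists_schreier_sum {m : ℕ} {a : Fin (m + 1) → Ordinal.{0}} {p : Fin (m + 1) → ℕ}
    (ha : StrictAnti a) (ha0 : ∀ i, 0 < a i) (hp : ∀ i, 1 ≤ p i)
    (h : ∀ i, ∀ X : Set ℕ+, X.Infinite → ∃ A, IsInitSeg A X ∧ Schreier lam (ω ^ a i) A)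
    {X : Set ℕ+} (hX : X.Infinite) :
    ∃ A, IsInitSeg A X ∧
      Schreier lam (List.ofFn fun i => ω ^ a i * (p i : Ordinal.{0})).sum A := by
  by_cases hpm : 1 < p 0 ∨ 1 ≤ m
  · -- The blocks of the lower powers of `ω` come first.
    let ι := Σₗ i : (Fin (m + 1))ᵒᵈ, Fin (p (OrderDual.ofDual i))
    obtain ⟨t, ht, hlt, hinit⟩ := exists_isInitSeg_biUnion
      (fun q : ι => h (OrderDual.ofDual (ofLex q).1)) hX
    let t' (i : Fin (m + 1)) (x : Fin (p i)) : Finset ℕ+ := t (toLex ⟨OrderDual.toDual i, x⟩)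
    have hunion : (Finset.univ.biUnion fun i => Finset.univ.biUnion (t' i)) =
        Finset.univ.biUnion t := by
      ext z
      simp only [Finset.mem_biUnion, Finset.mem_univ, true_and]
      exact ⟨fun ⟨i, x, hz⟩ => ⟨_, hz⟩, fun ⟨⟨i, x⟩, hz⟩ => ⟨i, x, hz⟩⟩
    refine ⟨_, hunion ▸ hinit, .sum m a p t' ha ha0 hp hpm
      (fun i x y hxy => hlt _ _ (Sigma.Lex.right _ _ hxy))
      (fun i j hij x y => hlt _ _ (Sigma.Lex.left _ _ (OrderDual.toDual_lt_toDual.2 hij)))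
      fun i x => ht (toLex ⟨OrderDual.toDual i, x⟩)⟩
  · obtain rfl : m = 0 := by omega
    have hp0 : p 0 = 1 := by have := hp 0; omega
    simpa [hp0] using h 0 X hX

theorem exists_schreier (hlam : IsFundamentalSystem lam) {ξ : Ordinal.{0}} (hξ : ξ < ω_ 1)
    {X : Set ℕ+} (hX : X.Infinite) : ∃ A, IsInitSeg A X ∧ Schreier lam ξ A := by
  induction ξ using Ordinal.limitRecOn generalizing X with
  | zero => exact ⟨∅, by simp [IsInitSeg], .zero⟩
  | add_one ζ ih =>
    exact exists_schreier_add_one (fun X hX => ih ((lt_add_one ζ).trans hξ) hX) hX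
  | limit ξ hl _ =>
    obtain ⟨m, a, p, ha, ha0, hp, rfl⟩ := exists_eq_sum_opow hl.ne_bot
      (Ordinal.isSuccPrelimit_iff_omega0_dvd.1 hl.isSuccPrelimit)
    refine exists_schreier_sum ha ha0 hp (fun i X hX => exists_schreier_opow hlam ?_ hX) hX
    calc a i ≤ ω ^ a i := Ordinal.right_le_opow _ Ordinal.one_lt_omega0
      _ ≤ _ := opow_le_sum_opow a p (hp i)
      _ < ω_ 1 := hξ

theorem schreier_iff_reach (hlam : IsFundamentalSystem lam) {ξ : Ordinal.{0}} (hξ : ξ < ω_ 1)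
    {A : Finset ℕ+} : Schreier lam ξ A ↔ Reach lam ξ A 0 := by
  refine ⟨fun h => h.reach hlam hξ, fun h => ?_⟩
  -- A member of `𝓐_ξ` that is an initial segment of an infinite end-extension of `A` must be `A`.
  obtain ⟨m, hm⟩ := A.bddAbove
  have hX : ((A : Set ℕ+) ∪ Set.Ioi m).Infinite := (Set.Ioi_infinite m).mono Set.subset_union_right
  obtain ⟨B, hB, hS⟩ := exists_schreier hlam hξ hX
  have hR := hS.reach hlam hξ
  by_cases hBA : B ⊆ A
  · have hBA' : IsInitSeg B (A : Set ℕ+) := ⟨hBA, fun x hx y hy => hB.2 x hx y (Or.inl hy)⟩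
    rwa [← hR.eq_of_isInitSeg h hBA']
  · obtain ⟨z, hzB, hzA⟩ := Finset.not_subset.1 hBA
    have hmz : m < z := (hB.1 hzB).resolve_left hzA
    have hAB : IsInitSeg A (B : Set ℕ+) := by
      refine ⟨fun x hx => ?_, fun x hx y hy hyA =>
        (hm hx).trans_lt ((hB.1 hy).resolve_left hyA)⟩
      by_contra hxB
      exact (hB.2 z hzB x (Or.inl hx) hxB).asymm ((hm hx).trans_lt hmz)
    rwa [h.eq_of_isInitSeg hR hAB]

theorem reach_or_exists_isInitSeg (ξ : Ordinal.{0}) (A : Finset ℕ+) :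
    (∃ ρ, ρ ≠ 0 ∧ Reach lam ξ A ρ) ∨ ∃ B, IsInitSeg B (A : Set ℕ+) ∧ Reach lam ξ B 0 := by
  induction A using Finset.induction_on_max with
  | empty =>
    by_cases h : ξ = 0
    · exact Or.inr ⟨∅, by simp [IsInitSeg], h ▸ .nil⟩
    · exact Or.inl ⟨ξ, h, .nil⟩
  | insert n A hn ih =>
    rcases ih with ⟨ρ, hρ, h⟩ | ⟨B, hB, h⟩
    · by_cases h0 : fundSeq lam ρ n = 0
      · exact Or.inr ⟨insert n A, ⟨subset_rfl, fun _ _ _ hy hyA => absurd hy hyA⟩,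
          h0 ▸ h.snoc hρ hn⟩
      · exact Or.inl ⟨_, h0, h.snoc hρ hn⟩
    · refine Or.inr ⟨B, ⟨?_, fun x hx y hy hyB => ?_⟩, h⟩
      · exact hB.1.trans (Finset.coe_subset.2 (Finset.subset_insert n A))
      · rcases Finset.mem_insert.1 hy with rfl | hy
        · exact hn x (hB.1 hx)
        · exact hB.2 x hx y hy hyB

/-! ### Disjoint collections and their unions -/

section Collections

variable {a b t u : Finset ℕ+} {s : Finset (Finset ℕ+)} {S S' D D₁ D₂ : Set (Finset ℕ+)}

theorem BlockLT.mono {a' b' : Finset ℕ+} (h : BlockLT a b) (ha : a' ⊆ a) (hb : b' ⊆ b) :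
    BlockLT a' b' := fun x hx y hy => h x (ha hx) y (hb hy)

theorem BlockLT.irrefl (ha : a.Nonempty) : ¬ BlockLT a a := fun h =>
  let ⟨x, hx⟩ := ha; (h x hx x hx).false

theorem BlockLT.asymm (ha : a.Nonempty) (hb : b.Nonempty) (h : BlockLT a b) : ¬ BlockLT b a :=
  fun h' => let ⟨x, hx⟩ := ha; let ⟨y, hy⟩ := hb; (h x hx y hy).asymm (h' y hy x hx)

theorem blockLT_union : BlockLT (a ∪ b) t ↔ BlockLT a t ∧ BlockLT b t := by
  simp only [BlockLT, Finset.mem_union]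
  grind

/-- The union of the members of a finite collection. -/
def supp (s : Finset (Finset ℕ+)) : Finset ℕ+ := s.biUnion id

theorem subset_supp (ha : a ∈ s) : a ⊆ supp s := Finset.subset_biUnion_of_mem id ha

theorem blockLT_supp : BlockLT (supp s) t ↔ ∀ a ∈ s, BlockLT a t := by
  simp only [BlockLT, supp, Finset.mem_biUnion, id]
  grind

/-- The least element of a nonempty finite set (and the junk value `1` for `∅`). -/
def minOf (a : Finset ℕ+) : ℕ+ := a.min.untopD 1

theorem isLeast_minOf (ha : a.Nonempty) : IsLeast (a : Set ℕ+) (minOf a) := by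
  have h : minOf a = a.min' ha := by rw [minOf, ← Finset.coe_min' ha, WithTop.untopD_coe]
  exact h ▸ Finset.isLeast_min' a ha

theorem BlockLT.minOf_lt (h : BlockLT a b) (ha : a.Nonempty) (hb : b.Nonempty) :
    minOf a < minOf b :=
  h _ (isLeast_minOf ha).1 _ (isLeast_minOf hb).1

theorem IsDisjointCollection.mono (hS : IsDisjointCollection S) (h : S' ⊆ S) :
    IsDisjointCollection S' :=
  ⟨fun a ha => hS.1 a (h ha), hS.2.mono h⟩

theorem IsDisjointCollection.blockLT_of_minOf_le (hS : IsDisjointCollection S) (ha : a ∈ S)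
    (hb : b ∈ S) (hab : a ≠ b) (hle : minOf a ≤ minOf b) : BlockLT a b :=
  (hS.2 ha hb hab).resolve_right fun h => (h.minOf_lt (hS.1 b hb) (hS.1 a ha)).not_ge hle

theorem IsDisjointCollection.injOn_minOf (hS : IsDisjointCollection S) : S.InjOn minOf := by
  intro a ha b hb hab
  by_contra hne
  exact ((hS.blockLT_of_minOf_le ha hb hne hab.le).minOf_lt (hS.1 a ha) (hS.1 b hb)).ne hab

theorem empty_mem_finColl : ∅ ∈ finColl := by
  simp [finColl, IsDisjointCollection]

theorem insert_mem_finColl (hs : s ∈ finColl) (ht : t.Nonempty) (hst : BlockLT (supp s) t) :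
    insert t s ∈ finColl := by
  rw [blockLT_supp] at hst
  simp only [finColl, IsDisjointCollection, Finset.coe_insert, Set.mem_ofPred_eq] at hs ⊢
  refine ⟨Set.forall_mem_insert.2 ⟨ht, hs.1⟩, ?_⟩
  exact hs.2.insert fun a ha _ => ⟨Or.inr (hst a ha), Or.inl (hst a ha)⟩

theorem exists_first_block (hs : s ∈ finColl) (hne : s.Nonempty) :
    ∃ a r, s = insert a r ∧ a.Nonempty ∧ ∀ b ∈ r, BlockLT a b := by
  obtain ⟨a, ha, hmin⟩ := Finset.exists_min_image s minOf hne
  refine ⟨a, s.erase a, (Finset.insert_erase ha).symm, hs.1 a ha, fun b hb => ?_⟩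
  have hbs := Finset.mem_of_mem_erase hb
  exact IsDisjointCollection.blockLT_of_minOf_le hs ha hbs (Finset.ne_of_mem_erase hb).symm
    (hmin b hbs)

theorem subset_FU (S : Set (Finset ℕ+)) : S ⊆ FU S := fun a ha =>
  ⟨{a}, Finset.singleton_nonempty a, by simpa using ha, by simp⟩

theorem union_mem_FU (ha : a ∈ FU S) (hb : b ∈ FU S) : a ∪ b ∈ FU S := by
  obtain ⟨T, hT, hTS, rfl⟩ := ha
  obtain ⟨U, -, hUS, rfl⟩ := hb
  refine ⟨T ∪ U, hT.mono Finset.subset_union_left, ?_, Finset.union_biUnion.symm⟩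
  rw [Finset.coe_union]
  exact Set.union_subset hTS hUS

theorem FU_subset_FU (h : S ⊆ FU S') : FU S ⊆ FU S' := by
  rintro _ ⟨T, hT, hTS, rfl⟩
  induction hT using Finset.Nonempty.cons_induction with
  | singleton a => simpa using h (hTS (by simp))
  | cons a T ha _ ih =>
    rw [Finset.cons_eq_insert, Finset.biUnion_insert]
    rw [Finset.coe_cons, Set.insert_subset_iff] at hTS
    exact union_mem_FU (h hTS.1) (ih hTS.2)

theorem FU_mono (h : S ⊆ S') : FU S ⊆ FU S' := FU_subset_FU (h.trans (subset_FU S'))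

theorem FU_empty : FU ∅ = ∅ :=
  Set.eq_empty_of_forall_notMem fun _ ⟨_, ⟨_, hx⟩, hT, _⟩ => hT hx

theorem mem_FU_range {ι : Type*} {f : ι → Finset ℕ+} :
    u ∈ FU (Set.range f) ↔ ∃ I : Finset ι, I.Nonempty ∧ u = I.biUnion f := by
  classical
  constructor
  · rintro ⟨T, hT, hTf, rfl⟩
    rw [← Set.image_univ] at hTf
    obtain ⟨I, -, rfl⟩ := Finset.subset_set_image_iff.1 hTf
    exact ⟨I, Finset.image_nonempty.1 hT, Finset.image_biUnion⟩
  · rintro ⟨I, hI, rfl⟩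
    exact ⟨I.image f, hI.image f, by simp, by simp [Finset.image_biUnion]⟩

theorem nonempty_of_mem_FU (hS : ∀ a ∈ S, a.Nonempty) (hu : u ∈ FU S) : u.Nonempty := by
  obtain ⟨T, ⟨a, ha⟩, hTS, rfl⟩ := hu
  exact (hS a (hTS ha)).mono (subset_supp ha)

theorem subset_supp_of_mem_FU (hu : u ∈ FU (s : Set (Finset ℕ+))) : u ⊆ supp s := by
  obtain ⟨T, -, hTS, rfl⟩ := hu
  exact Finset.biUnion_subset_biUnion_of_subset_left _ (Finset.coe_subset.1 hTS)

theorem supp_subset_supp {t : Finset (Finset ℕ+)}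
    (h : (t : Set (Finset ℕ+)) ⊆ FU (s : Set (Finset ℕ+))) : supp t ⊆ supp s :=
  Finset.biUnion_subset.2 fun _ ha => subset_supp_of_mem_FU (h ha)

theorem finCollIn_mono (h : D ⊆ FU D₁) : finCollIn D ⊆ finCollIn D₁ :=
  fun _ hs => ⟨hs.1, hs.2.trans (FU_subset_FU h)⟩

theorem empty_mem_finCollIn (D : Set (Finset ℕ+)) : ∅ ∈ finCollIn D :=
  ⟨empty_mem_finColl, by simp⟩

theorem infCollIn_self (hD : D ∈ infColl) : D ∈ infCollIn D := ⟨hD, subset_FU D⟩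

theorem infCollIn_trans (h₁ : D₁ ∈ infCollIn D) (h₂ : D₂ ∈ infCollIn D₁) : D₂ ∈ infCollIn D :=
  ⟨h₂.1, h₂.2.trans (FU_subset_FU h₁.2)⟩

theorem insert_mem_finCollIn (hD : D ∈ infColl) (hs : s ∈ finCollIn D) (ht : t ∈ FU D)
    (hst : BlockLT (supp s) t) : insert t s ∈ finCollIn D := by
  refine ⟨insert_mem_finColl hs.1 (nonempty_of_mem_FU hD.2.1 ht) hst, ?_⟩
  rw [Finset.coe_insert]
  exact Set.insert_subset ht hs.2

theorem range_mem_infColl {f : ℕ → Finset ℕ+} (hne : ∀ n, (f n).Nonempty)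
    (hf : ∀ m n, m < n → BlockLT (f m) (f n)) : Set.range f ∈ infColl := by
  have hpair : Pairwise fun m n => BlockLT (f m) (f n) ∨ BlockLT (f n) (f m) := fun m n hmn =>
    (lt_or_gt_of_ne hmn).imp (hf m n) (hf n m)
  refine ⟨Set.infinite_range_of_injective fun m n hmn => ?_, Set.forall_mem_range.2 hne, ?_⟩
  · by_contra h
    exact BlockLT.irrefl (hne n) (by simpa only [hmn, or_self] using hpair h)
  · rintro _ ⟨m, rfl⟩ _ ⟨n, rfl⟩ h
    exact hpair fun hmn => h (hmn ▸ rfl)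

theorem exists_infColl_subset (hne : ∀ a ∈ S, a.Nonempty) (h : ∀ a, ∃ d ∈ S, BlockLT a d) :
    ∃ E ∈ infColl, E ⊆ S := by
  obtain ⟨f, hfS, hf⟩ := exists_seq_of_forall_finset_exists (· ∈ S) BlockLT fun s _ =>
    let ⟨d, hd, hsd⟩ := h (supp s); ⟨d, hd, blockLT_supp.1 hsd⟩
  exact ⟨_, range_mem_infColl (fun n => hne _ (hfS n)) hf, Set.range_subset_iff.2 hfS⟩

theorem exists_blockLT (hD : D ∈ infColl) (a : Finset ℕ+) : ∃ d ∈ D, BlockLT a d := by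
  obtain ⟨m, hm⟩ := a.bddAbove
  obtain ⟨_, ⟨d, hd, rfl⟩, hmd⟩ := (hD.1.image hD.2.injOn_minOf).exists_gt m
  exact ⟨d, hd, fun x hx y hy =>
    ((hm hx).trans_lt hmd).trans_le ((isLeast_minOf (hD.2.1 d hd)).2 hy)⟩

/-- The members of `D` lying after the finite set `a`. -/
def after (D : Set (Finset ℕ+)) (a : Finset ℕ+) : Set (Finset ℕ+) := {d | d ∈ D ∧ BlockLT a d}

theorem after_mem_infCollIn (hD : D ∈ infColl) (a : Finset ℕ+) : after D a ∈ infCollIn D := by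
  refine ⟨⟨fun hfin => ?_, hD.2.mono fun d hd => hd.1⟩, fun d hd => subset_FU D hd.1⟩
  obtain ⟨d, hd, had⟩ := exists_blockLT hD (a ∪ supp hfin.toFinset)
  rw [blockLT_union] at had
  have hmem : d ∈ hfin.toFinset := hfin.mem_toFinset.2 ⟨hd, had.1⟩
  exact BlockLT.irrefl (hD.2.1 d hd) (had.2.mono (subset_supp hmem) Finset.Subset.rfl)

theorem mem_FU_after_iff : t ∈ FU (after D a) ↔ t ∈ FU D ∧ BlockLT a t := by
  constructor
  · refine fun ht => ⟨FU_mono (fun d hd => hd.1) ht, ?_⟩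
    obtain ⟨T, -, hTD, rfl⟩ := ht
    intro x hx y hy
    obtain ⟨d, hd, hyd⟩ := Finset.mem_biUnion.1 hy
    exact (hTD hd).2 x hx y hyd
  · rintro ⟨⟨T, hT, hTD, rfl⟩, hat⟩
    exact ⟨T, hT, fun d hd => ⟨hTD hd, hat.mono Finset.Subset.rfl (subset_supp hd)⟩, rfl⟩

end Collections

/-! ### Thin families of blocks -/

section Mins

variable {ξ ρ : Ordinal.{0}} {t : Finset ℕ+} {s : Finset (Finset ℕ+)}

/-- The set of the least elements of the members of a collection. -/
def mins (s : Finset (Finset ℕ+)) : Finset ℕ+ := s.image minOf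

theorem coe_mins (hs : s ∈ finColl) :
    (mins s : Set ℕ+) = {m | ∃ a ∈ s, IsLeast (a : Set ℕ+) m} := by
  ext m
  simp only [mins, Finset.coe_image, Set.mem_image, Finset.mem_coe, Set.mem_ofPred_eq]
  refine exists_congr fun a => and_congr_right fun ha => ?_
  have h := isLeast_minOf (hs.1 a ha)
  exact ⟨fun e => e ▸ h, fun h' => h.unique h'⟩

theorem mins_insert (s : Finset (Finset ℕ+)) (t : Finset ℕ+) :
    mins (insert t s) = insert (minOf t) (mins s) := Finset.image_insert _ _ _

theorem mins_lt (hs : s ∈ finColl) (ht : t.Nonempty) (hst : BlockLT (supp s) t) :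
    ∀ x ∈ mins s, x < minOf t := by
  intro x hx
  obtain ⟨a, ha, rfl⟩ := Finset.mem_image.1 hx
  exact (blockLT_supp.1 hst a ha).minOf_lt (hs.1 a ha) ht

theorem Reach.insert_block (h : Reach lam ξ (mins s) ρ) (hρ : ρ ≠ 0) (hs : s ∈ finColl)
    (ht : t.Nonempty) (hst : BlockLT (supp s) t) :
    Reach lam ξ (mins (insert t s)) (fundSeq lam ρ (minOf t)) := by
  rw [mins_insert]
  exact h.snoc hρ (mins_lt hs ht hst)

/-- The block family `𝓑^ξ`, described by walks along fundamental sequences. -/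
def thinFamily (lam : Ordinal.{0} → ℕ+ → Ordinal.{0}) (ξ : Ordinal.{0}) :
    Set (Finset (Finset ℕ+)) :=
  {s | s ∈ finColl ∧ Reach lam ξ (mins s) 0}

theorem blockSchreier_eq_thinFamily (hlam : IsFundamentalSystem lam) (hξ : ξ < ω_ 1) :
    blockSchreier lam ξ = thinFamily lam ξ := by
  ext s
  refine and_congr_right fun hs => ?_
  rw [← coe_mins hs]
  simp only [Finset.coe_inj, exists_eq_right, schreier_iff_reach hlam hξ]

end Mins

/-! ### Hindman's theorem for finite unions -/

theorem mem_FS_iff {M : Type*} [AddCommMonoid M] {a : Stream' M} {m : M} :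
    m ∈ Hindman.FS a ↔ ∃ I : Finset ℕ, I.Nonempty ∧ ∑ i ∈ I, a.get i = m := by
  refine ⟨fun hm => ?_, fun ⟨I, hI, hm⟩ => hm ▸ Hindman.FS.finsetSum a I hI⟩
  induction hm with
  | head' a => exact ⟨{0}, Finset.singleton_nonempty 0, Finset.sum_singleton _ _⟩
  | tail' a m _ ih =>
    obtain ⟨I, hI, rfl⟩ := ih
    exact ⟨I.map (addRightEmbedding 1), hI.map, Finset.sum_map _ _ _⟩
  | cons' a m _ ih =>
    obtain ⟨I, _, rfl⟩ := ih
    refine ⟨insert 0 (I.map (addRightEmbedding 1)), Finset.insert_nonempty _ _, ?_⟩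
    rw [Finset.sum_insert (by simp), Finset.sum_map]
    rfl

theorem nodup_and_toFinset_mem_FU {f : ℕ → Finset ℕ+} (hf : Pairwise (Disjoint on f))
    {m : Multiset ℕ+} (hm : m ∈ Hindman.FS fun n => (f n).val) :
    m.Nodup ∧ m.toFinset ∈ FU (Set.range f) := by
  obtain ⟨I, hI, rfl⟩ := mem_FS_iff.1 hm
  refine ⟨(I.disjiUnion f fun i _ j _ hij => hf hij).nodup, mem_FU_range.2 ⟨I, hI, ?_⟩⟩
  ext x
  simp [Multiset.mem_sum, Stream'.get]

theorem exists_blockLT_of_pairwise_disjoint {f : ℕ → Finset ℕ+} (hf : Pairwise (Disjoint on f))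
    (e : Finset ℕ+) : ∃ n, BlockLT e (f n) := by
  by_contra! hcon
  have hle : ∀ n, ∃ x ∈ f n, ∃ y ∈ e, x ≤ y := fun n => by
    have := hcon n
    simp only [BlockLT] at this
    grind
  choose x hx y hy hxy using hle
  obtain ⟨m, hm⟩ := e.bddAbove
  have hinj : Function.Injective x := fun i j hij => by
    by_contra hne
    exact Finset.disjoint_left.1 (hf hne) (hx i) (hij ▸ hx j)
  refine Set.infinite_range_of_injective hinj ((Set.finite_Iic m).subset ?_)
  rintro _ ⟨n, rfl⟩
  exact (hxy n).trans (hm (hy n))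

theorem exists_infCollIn_FU_subset_FS {D : Set (Finset ℕ+)} (hD : ∀ d ∈ D, d.Nonempty)
    {b : Stream' (Multiset ℕ+)}
    (hb : ∀ m ∈ Hindman.FS b, m.Nodup ∧ m.toFinset ∈ FU D) :
    ∃ E ∈ infCollIn D, FU E ⊆ Multiset.toFinset '' Hindman.FS b := by
  let g : ℕ → Finset ℕ+ := fun n => (b.get n).toFinset
  have hgD : ∀ n, g n ∈ FU D := fun n => (hb _ (Hindman.FS.singleton b n)).2
  have hlt : ∀ i j, i < j → Disjoint (g i) (g j) := fun i j hij =>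
    Multiset.disjoint_toFinset.2
      (Multiset.nodup_add.1 (hb _ (Hindman.FS.add_two b i j hij)).1).2.2
  have hdisj : Pairwise (Disjoint on g) := fun i j hij =>
    (lt_or_gt_of_ne hij).elim (hlt i j) fun h => (hlt j i h).symm
  obtain ⟨E, hE, hEg⟩ := exists_infColl_subset (S := Set.range g)
    (Set.forall_mem_range.2 fun n => nonempty_of_mem_FU hD (hgD n))
    fun e => Set.exists_range_iff.2 (exists_blockLT_of_pairwise_disjoint hdisj e)
  refine ⟨E, ⟨hE, hEg.trans (Set.range_subset_iff.2 hgD)⟩, fun u hu => ?_⟩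
  obtain ⟨I, hI, rfl⟩ := mem_FU_range.1 (FU_mono hEg hu)
  refine ⟨_, mem_FS_iff.2 ⟨I, hI, rfl⟩, ?_⟩
  ext x
  simp [g, Multiset.mem_sum]

theorem exists_infCollIn_monochromatic {D : Set (Finset ℕ+)} (hD : D ∈ infColl)
    (C : Set (Finset ℕ+)) : ∃ D₁ ∈ infCollIn D, FU D₁ ⊆ C ∨ FU D₁ ⊆ Cᶜ := by
  obtain ⟨f, hfD, hf⟩ := exists_seq_of_forall_finset_exists (· ∈ D) BlockLT fun s _ =>
    let ⟨d, hd, hsd⟩ := exists_blockLT hD (supp s); ⟨d, hd, blockLT_supp.1 hsd⟩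
  have hdisj : Pairwise (Disjoint on f) := fun m n hmn => Finset.disjoint_left.2 fun x hm hn =>
    (lt_or_gt_of_ne hmn).elim (fun h => (hf m n h x hm x hn).false)
      fun h => (hf n m h x hn x hm).false
  let a : Stream' (Multiset ℕ+) := fun n => (f n).val
  have ha : ∀ m ∈ Hindman.FS a, m.Nodup ∧ m.toFinset ∈ FU D := fun m hm =>
    (nodup_and_toFinset_mem_FU hdisj hm).imp_right (FU_mono (Set.range_subset_iff.2 hfD) ·)
  let X : Set (Multiset ℕ+) := Multiset.toFinset ⁻¹' C
  obtain ⟨c, hc, b, hbc⟩ := Hindman.FS_partition_regular a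
    {Hindman.FS a ∩ X, Hindman.FS a \ X} (by simp) (by
      rw [Set.sUnion_pair, Set.inter_union_sdiff])
  have hca : c ⊆ Hindman.FS a := by
    rcases hc with rfl | rfl
    exacts [Set.inter_subset_left, Set.sdiff_subset]
  obtain ⟨E, hE, hEb⟩ := exists_infCollIn_FU_subset_FS hD.2.1 fun m hm => ha m (hca (hbc hm))
  refine ⟨E, hE, ?_⟩
  rcases hc with rfl | rfl
  · exact Or.inl (hEb.trans (Set.image_subset_iff.2 fun m hm => (hbc hm).2))
  · exact Or.inr (hEb.trans (Set.image_subset_iff.2 fun m hm => (hbc hm).2))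

/-! ### Fusion -/

/-- A fusion sequence: a decreasing sequence of infinite disjoint collections `E n`, together with
members `a n` of the `E n` such that `E (n + 1)` lies entirely after `a n`. -/
structure IsFusion (E : ℕ → Set (Finset ℕ+)) (a : ℕ → Finset ℕ+) : Prop where
  zero_mem : E 0 ∈ infColl
  mem : ∀ n, a n ∈ E n
  succ_mem : ∀ n, E (n + 1) ∈ infCollIn (after (E n) (a n))

namespace IsFusion

variable {E : ℕ → Set (Finset ℕ+)} {a : ℕ → Finset ℕ+}

theorem mem_infColl (h : IsFusion E a) : ∀ n, E n ∈ infColl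
  | 0 => h.zero_mem
  | n + 1 => (h.succ_mem n).1

theorem nonempty (h : IsFusion E a) (n : ℕ) : (a n).Nonempty := (h.mem_infColl n).2.1 _ (h.mem n)

theorem mem_infCollIn (h : IsFusion E a) {m n : ℕ} (hmn : m ≤ n) : E n ∈ infCollIn (E m) := by
  induction n, hmn using Nat.le_induction with
  | base => exact infCollIn_self (h.mem_infColl m)
  | succ n _ ih =>
    exact infCollIn_trans ih
      (infCollIn_trans (after_mem_infCollIn (h.mem_infColl n) _) (h.succ_mem n))

theorem mem_FU (h : IsFusion E a) {m n : ℕ} (hmn : m ≤ n) : a n ∈ FU (E m) :=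
  (h.mem_infCollIn hmn).2 (h.mem n)

theorem blockLT (h : IsFusion E a) {m n : ℕ} (hmn : m < n) : BlockLT (a m) (a n) :=
  (mem_FU_after_iff.1 (FU_subset_FU (h.succ_mem m).2 (h.mem_FU hmn))).2

theorem range_mem_infCollIn (h : IsFusion E a) : Set.range a ∈ infCollIn (E 0) :=
  ⟨range_mem_infColl h.nonempty fun _ _ => h.blockLT,
    Set.range_subset_iff.2 fun n => h.mem_FU n.zero_le⟩

theorem after_range_subset (h : IsFusion E a) (n : ℕ) :
    after (Set.range a) (a n) ⊆ FU (E (n + 1)) := by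
  rintro _ ⟨⟨k, rfl⟩, hk⟩
  refine h.mem_FU (Nat.lt_of_not_le fun hkn => ?_)
  rcases hkn.eq_or_lt with rfl | hkn
  · exact BlockLT.irrefl (h.nonempty k) hk
  · exact BlockLT.asymm (h.nonempty k) (h.nonempty n) (h.blockLT hkn) hk

theorem exists_last (h : IsFusion E a) {u : Finset ℕ+} (hu : u ∈ FU (Set.range a)) :
    ∃ n, a n ⊆ u ∧ u ⊆ (a n).biUnion Finset.Iic := by
  obtain ⟨I, hI, rfl⟩ := mem_FU_range.1 hu
  refine ⟨I.max' hI, Finset.subset_biUnion_of_mem a (I.max'_mem hI), ?_⟩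
  refine Finset.biUnion_subset.2 fun i hi x hx => ?_
  rw [Finset.mem_biUnion]
  rcases (I.le_max' i hi).eq_or_lt with heq | hlt
  · exact ⟨x, heq ▸ hx, Finset.mem_Iic.2 le_rfl⟩
  · obtain ⟨y, hy⟩ := h.nonempty (I.max' hI)
    exact ⟨y, hy, Finset.mem_Iic.2 (h.blockLT hlt x hx y hy).le⟩

end IsFusion

theorem exists_isFusion {Q : Finset ℕ+ → Set (Finset ℕ+) → Prop}
    (hQ : ∀ a, ∀ E ∈ infColl, ∃ E' ∈ infCollIn E, Q a E') {D : Set (Finset ℕ+)}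
    (hD : D ∈ infColl) :
    ∃ E a, IsFusion E a ∧ E 0 = D ∧ ∀ n, Q (a n) (E (n + 1)) := by
  have hstep : ∀ E : infColl, ∃ (a : Finset ℕ+) (E' : infColl),
      a ∈ E.1 ∧ E'.1 ∈ infCollIn (after E.1 a) ∧ Q a E'.1 := fun E => by
    obtain ⟨a, ha⟩ := E.2.1.nonempty
    obtain ⟨E', hE', hQE'⟩ := hQ a _ (after_mem_infCollIn E.2 a).1
    exact ⟨a, ⟨E', hE'.1⟩, ha, hE', hQE'⟩
  choose a next ha hnext hQa using hstep
  let E : ℕ → infColl := fun n => next^[n] ⟨D, hD⟩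
  have hE : ∀ n, E (n + 1) = next (E n) := fun n => Function.iterate_succ_apply' _ _ _
  refine ⟨fun n => E n, fun n => a (E n), ⟨hD, fun n => ha _, fun n => ?_⟩, rfl, fun n => ?_⟩
  · simpa only [hE] using hnext (E n)
  · simpa only [hE] using hQa (E n)

theorem exists_infCollIn_forall_mem {ι : Type*} {P : ι → Set (Finset ℕ+) → Prop}
    (hmono : ∀ a E E', E' ⊆ FU E → P a E → P a E')
    (hP : ∀ a, ∀ E ∈ infColl, ∃ E' ∈ infCollIn E, P a E') (S : Finset ι)
    {E : Set (Finset ℕ+)} (hE : E ∈ infColl) : ∃ E' ∈ infCollIn E, ∀ a ∈ S, P a E' := by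
  classical
  induction S using Finset.induction_on with
  | empty => exact ⟨E, infCollIn_self hE, by simp⟩
  | insert a S _ ih =>
    obtain ⟨E₁, hE₁, hS⟩ := ih
    obtain ⟨E₂, hE₂, ha⟩ := hP a E₁ hE₁.1
    refine ⟨E₂, infCollIn_trans hE₁ hE₂, ?_⟩
    exact Finset.forall_mem_insert .. |>.2 ⟨ha, fun b hb => hmono _ _ _ hE₂.2 (hS b hb)⟩

/-- When `a n` is chosen, the property is decided for all the (finitely many) `b` below the maximum
of `a n`; these include all the unions of `a 0, …, a n`. -/
theorem exists_infCollIn_fusion {P : Finset ℕ+ → Set (Finset ℕ+) → Prop}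
    (hmono : ∀ a E E', E' ⊆ FU E → P a E → P a E')
    (hP : ∀ a, ∀ E ∈ infColl, ∃ E' ∈ infCollIn E, P a E') {D : Set (Finset ℕ+)}
    (hD : D ∈ infColl) : ∃ D₁ ∈ infCollIn D, ∀ a ∈ FU D₁, P a (after D₁ a) := by
  obtain ⟨E, a, h, rfl, hPa⟩ := exists_isFusion
    (Q := fun a E => ∀ b ∈ (a.biUnion Finset.Iic).powerset, P b E)
    (fun a E hE => exists_infCollIn_forall_mem hmono hP _ hE) hD
  refine ⟨Set.range a, h.range_mem_infCollIn, fun u hu => ?_⟩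
  obtain ⟨n, hnu, hun⟩ := h.exists_last hu
  have hsub : after (Set.range a) u ⊆ FU (E (n + 1)) := fun d hd =>
    h.after_range_subset n ⟨hd.1, hd.2.mono hnu Finset.Subset.rfl⟩
  exact hmono u _ _ hsub (hPa n u (Finset.mem_powerset.2 hun))

/-! ### Homogeneity for the thin families -/

theorem thinFamily_zero : thinFamily lam 0 = {∅} := by
  ext s
  refine ⟨fun h => Finset.image_eq_empty.1 (?_ : mins s = ∅), ?_⟩
  · by_contra hne
    obtain ⟨n, hn⟩ := exists_isLeast (Finset.coe_nonempty.2 (Finset.nonempty_iff_ne_empty.2 hne))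
    obtain ⟨_, _, _, h0, _⟩ := h.2.exists_first hn
    exact h0 rfl
  · rintro rfl
    exact ⟨empty_mem_finColl, Reach.nil⟩

theorem exists_eq_insert_of_mem_thinFamily {ξ : Ordinal.{0}} (hξ : ξ ≠ 0)
    {s : Finset (Finset ℕ+)} (h : s ∈ thinFamily lam ξ) :
    ∃ a r, s = insert a r ∧ (∀ b ∈ r, BlockLT a b) ∧
      r ∈ thinFamily lam (fundSeq lam ξ (minOf a)) := by
  obtain ⟨hs, hR⟩ := h
  have hne : s.Nonempty := by
    rw [Finset.nonempty_iff_ne_empty]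
    rintro rfl
    exact hξ hR.of_empty.symm
  obtain ⟨a, r, rfl, ha, hr⟩ := exists_first_block hs hne
  have hrs : r ∈ finColl := IsDisjointCollection.mono hs (by simp)
  refine ⟨a, r, rfl, hr, hrs, ?_⟩
  rw [mins_insert] at hR
  refine (hR.first fun x hx => ?_).2
  obtain ⟨b, hb, rfl⟩ := Finset.mem_image.1 hx
  exact (hr b hb).minOf_lt ha (hrs.1 b hb)

theorem exists_homogeneous (lam : Ordinal.{0} → ℕ+ → Ordinal.{0}) (ξ : Ordinal.{0})
    (F : Set (Finset (Finset ℕ+))) {D : Set (Finset ℕ+)} (hD : D ∈ infColl) :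
    ∃ D₁ ∈ infCollIn D,
      thinFamily lam ξ ∩ finCollIn D₁ ⊆ F ∨ thinFamily lam ξ ∩ finCollIn D₁ ⊆ Fᶜ := by
  induction ξ using WellFoundedLT.induction generalizing F D with
  | ind ξ ih =>
  rcases eq_or_ne ξ 0 with rfl | hξ
  · refine ⟨D, infCollIn_self hD, ?_⟩
    rw [thinFamily_zero]
    refine (em (∅ ∈ F)).imp ?_ ?_ <;> rintro h _ ⟨rfl, -⟩ <;> exact h
  let S : Finset ℕ+ → Set (Finset (Finset ℕ+)) := fun a => thinFamily lam (fundSeq lam ξ (minOf a))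
  let F' : Finset ℕ+ → Set (Finset (Finset ℕ+)) := fun a => {r | insert a r ∈ F}
  have hmono : ∀ a {E E'} (H : Set (Finset (Finset ℕ+))), E' ⊆ FU E →
      S a ∩ finCollIn E ⊆ H → S a ∩ finCollIn E' ⊆ H := fun a _ _ _ hE =>
    (Set.inter_subset_inter_right _ (finCollIn_mono hE)).trans
  obtain ⟨D₁, hD₁, hdec⟩ := exists_infCollIn_fusion
    (P := fun a E => S a ∩ finCollIn E ⊆ F' a ∨ S a ∩ finCollIn E ⊆ (F' a)ᶜ)
    (fun a _ _ hE => Or.imp (hmono a _ hE) (hmono a _ hE))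
    (fun a _ hE => ih _ (fundSeq_lt hξ _) (F' a) hE) hD
  obtain ⟨D₂, hD₂, hC⟩ := exists_infCollIn_monochromatic hD₁.1
    {a | S a ∩ finCollIn (after D₁ a) ⊆ F' a}
  refine ⟨D₂, infCollIn_trans hD₁ hD₂, ?_⟩
  have hsplit : ∀ s ∈ thinFamily lam ξ ∩ finCollIn D₂, ∃ a ∈ FU D₂, ∃ r,
      s = insert a r ∧ r ∈ S a ∩ finCollIn (after D₁ a) := by
    rintro s ⟨hsξ, hs⟩
    obtain ⟨a, r, rfl, hr, hrS⟩ := exists_eq_insert_of_mem_thinFamily hξ hsξ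
    have hsub := hs.2.trans (FU_subset_FU hD₂.2)
    exact ⟨a, hs.2 (by simp), r, rfl, hrS, hrS.1, fun b hb =>
      mem_FU_after_iff.2 ⟨hsub (Finset.mem_insert_of_mem hb), hr b hb⟩⟩
  refine hC.imp (fun hC s hs => ?_) fun hC s hs => ?_ <;>
    obtain ⟨a, ha, r, rfl, hr⟩ := hsplit s hs
  · exact hC ha hr
  · exact (hdec a (FU_subset_FU hD₂.2 ha)).resolve_left (hC ha) hr

theorem IsInitial.mem_finCollIn {D : Set (Finset ℕ+)} {s t : Finset (Finset ℕ+)}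
    (h : IsInitial t s) (hs : s ∈ finCollIn D) : t ∈ finCollIn D :=
  ⟨hs.1.mono (Finset.coe_subset.2 h.1), (Finset.coe_subset.2 h.1).trans hs.2⟩

theorem exists_isInitial_mins_eq {s : Finset (Finset ℕ+)} (hs : s ∈ finColl) {B : Finset ℕ+}
    (hB : IsInitSeg B (mins s : Set ℕ+)) : ∃ t, IsInitial t s ∧ mins t = B := by
  refine ⟨s.filter (minOf · ∈ B), ⟨Finset.filter_subset _ _, fun a ha b hb hbt => ?_⟩, ?_⟩
  · rw [Finset.mem_filter] at ha
    rw [Finset.mem_filter, not_and] at hbt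
    have hlt := hB.2 _ ha.2 _ (Finset.mem_image_of_mem minOf hb) (hbt hb)
    exact IsDisjointCollection.blockLT_of_minOf_le hs ha.1 hb (fun h => hlt.ne (h ▸ rfl)) hlt.le
  · have h : (mins s).filter (· ∈ B) = B := by
      rw [Finset.filter_mem_eq_inter, Finset.inter_eq_right]
      exact Finset.coe_subset.1 hB.1
    rwa [mins, Finset.filter_image] at h

theorem reach_or_exists_isInitial (lam : Ordinal.{0} → ℕ+ → Ordinal.{0}) (ξ : Ordinal.{0})
    {s : Finset (Finset ℕ+)} (hs : s ∈ finColl) :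
    (∃ ρ, ρ ≠ 0 ∧ Reach lam ξ (mins s) ρ) ∨ ∃ t ∈ thinFamily lam ξ, IsInitial t s := by
  refine (reach_or_exists_isInitSeg ξ (mins s)).imp_right ?_
  rintro ⟨B, hB, hR⟩
  obtain ⟨t, hts, rfl⟩ := exists_isInitial_mins_eq hs hB
  exact ⟨t, ⟨IsDisjointCollection.mono hs (Finset.coe_subset.2 hts.1), hR⟩, hts⟩

theorem Reach.exists_extension {ξ ρ : Ordinal.{0}} {D : Set (Finset ℕ+)} (hD : D ∈ infColl)
    {s : Finset (Finset ℕ+)} (h : Reach lam ξ (mins s) ρ) (hs : s ∈ finCollIn D) :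
    ∃ u ∈ thinFamily lam ξ ∩ finCollIn D, IsInitial s u := by
  induction ρ using WellFoundedLT.induction generalizing s with
  | ind ρ ih =>
  rcases eq_or_ne ρ 0 with rfl | hρ
  · exact ⟨s, ⟨⟨hs.1, h⟩, hs⟩, Finset.Subset.rfl, fun a _ b hb hbs => absurd hb hbs⟩
  · obtain ⟨t, ht, hst⟩ := exists_blockLT hD (supp s)
    obtain ⟨u, hu, hsu⟩ := ih _ (fundSeq_lt hρ _)
      (h.insert_block hρ hs.1 (hD.2.1 t ht) hst)
      (insert_mem_finCollIn hD hs (subset_FU D ht) hst)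
    refine ⟨u, hu, (Finset.subset_insert t s).trans hsu.1, fun a ha b hb hbs => ?_⟩
    rcases eq_or_ne b t with rfl | hbt
    · exact blockLT_supp.1 hst a ha
    · exact hsu.2 a (Finset.mem_insert_of_mem ha) b hb (by simp [hbt, hbs])

/-! ### Hereditary families -/

/-- A family is hereditary if it contains, with `s`, every finite disjoint collection of unions of
members of `s`. -/
def IsHereditary (G : Set (Finset (Finset ℕ+))) : Prop :=
  ∀ s ∈ G, ∀ t ∈ finColl, (t : Set (Finset ℕ+)) ⊆ FU (s : Set (Finset ℕ+)) → t ∈ G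

section Hereditary

variable {s t : Finset (Finset ℕ+)} {F G : Set (Finset (Finset ℕ+))} {D X : Set (Finset ℕ+)}

theorem isHereditary_hereditaryPart (F : Set (Finset (Finset ℕ+))) :
    IsHereditary (hereditaryPart F) := by
  rintro s (⟨_, h⟩ | rfl) t ht hts
  · exact Or.inl ⟨h t ht hts, fun u hu hut => h u hu (hut.trans (FU_subset_FU hts))⟩
  · rw [Finset.coe_empty, FU_empty, Set.subset_empty_iff, Finset.coe_eq_empty] at hts
    exact Or.inr hts

theorem IsTree.empty_mem (hT : IsTree F) : ∅ ∈ F := by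
  rw [← hT]
  exact Or.inr rfl

theorem IsTree.mem_of_isInitial (hT : IsTree F) (hs : s ∈ F) (ht : t ∈ finColl)
    (h : IsInitial t s) : t ∈ F := by
  rw [← hT]
  exact Or.inl ⟨ht, s, hs, h⟩

theorem hereditaryPart_subset (h0 : ∅ ∈ F) : hereditaryPart F ⊆ F := by
  rintro s (⟨h, _⟩ | rfl)
  exacts [h, h0]

theorem IsHereditary.mem_of_subset (hG : IsHereditary G) (hs : s ∈ G) (hsc : s ∈ finColl)
    (h : t ⊆ s) : t ∈ G :=
  hG s hs t (hsc.mono (Finset.coe_subset.2 h)) ((Finset.coe_subset.2 h).trans (subset_FU _))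

theorem IsHereditary.finCollIn_subset_iff (hG : IsHereditary G) (hX : IsDisjointCollection X) :
    finCollIn X ⊆ G ↔ ∀ Y : Finset (Finset ℕ+), (Y : Set (Finset ℕ+)) ⊆ X → Y ∈ G := by
  refine ⟨fun h Y hY => h ⟨hX.mono hY, hY.trans (subset_FU X)⟩, fun h s hs => ?_⟩
  have hT : ∀ u ∈ s, ∃ T : Finset (Finset ℕ+), (T : Set (Finset ℕ+)) ⊆ X ∧
      u ∈ FU (T : Set (Finset ℕ+)) := fun u hu =>
    let ⟨T, hT, hTX, huT⟩ := hs.2 hu; ⟨T, hTX, T, hT, subset_rfl, huT⟩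
  choose! T hTX hTu using hT
  refine hG (s.biUnion T) (h _ ?_) s hs.1 fun u hu => FU_mono ?_ (hTu u hu)
  · rw [Finset.coe_biUnion]
    exact Set.iUnion₂_subset hTX
  · exact Finset.coe_subset.2 (Finset.subset_biUnion_of_mem T hu)

theorem mins_subset_mins (hs : s ∈ finColl) (ht : t ∈ finColl)
    (h : (t : Set (Finset ℕ+)) ⊆ FU (s : Set (Finset ℕ+))) : mins t ⊆ mins s := by
  intro m hm
  obtain ⟨u, hu, rfl⟩ := Finset.mem_image.1 hm
  have hmu := isLeast_minOf (ht.1 u hu)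
  obtain ⟨T, -, hT, rfl⟩ := h hu
  obtain ⟨a, ha, hma⟩ := Finset.mem_biUnion.1 hmu.1
  have has := isLeast_minOf (hs.1 a (hT ha))
  exact Finset.mem_image.2
    ⟨a, hT ha, (has.2 hma).antisymm (hmu.2 (subset_supp ha has.1))⟩

theorem card_le_card_of_subset_FU (hs : s ∈ finColl) (ht : t ∈ finColl)
    (h : (t : Set (Finset ℕ+)) ⊆ FU (s : Set (Finset ℕ+))) : t.card ≤ s.card := by
  rw [← Finset.card_image_of_injOn (IsDisjointCollection.injOn_minOf hs),
    ← Finset.card_image_of_injOn (IsDisjointCollection.injOn_minOf ht)]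
  exact Finset.card_le_card (mins_subset_mins hs ht h)

end Hereditary

/-! ### Pointwise closed families -/

theorem mem_closure_pi_iff {ι : Type*} {Y : ι → Type*} [∀ i, TopologicalSpace (Y i)]
    [∀ i, DiscreteTopology (Y i)] {S : Set (∀ i, Y i)} {f : ∀ i, Y i} :
    f ∈ closure S ↔ ∀ I : Finset ι, ∃ g ∈ S, ∀ i ∈ I, g i = f i := by
  rw [mem_closure_iff]
  constructor
  · intro h I
    obtain ⟨g, hg, hgS⟩ := h ((I : Set ι).pi fun i => {f i})
      (isOpen_set_pi I.finite_toSet fun _ _ => isOpen_discrete _) (fun i _ => rfl)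
    exact ⟨g, hgS, fun i hi => hg i hi⟩
  · intro h o ho hfo
    obtain ⟨I, u, hu, hsub⟩ := isOpen_pi_iff.1 ho f hfo
    obtain ⟨g, hgS, hg⟩ := h I
    exact ⟨g, hsub fun i hi => (hg i hi).symm ▸ (hu i hi).2, hgS⟩

section PointwiseClosed

variable {H : Set (Finset (Finset ℕ+))} {D X : Set (Finset ℕ+)}

theorem not_pointwiseClosed (hX : X.Infinite)
    (h : ∀ Y : Finset (Finset ℕ+), (Y : Set (Finset ℕ+)) ⊆ X → Y ∈ H) : ¬ PointwiseClosed H := by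
  classical
  intro hcl
  have hmem : (fun a => decide (a ∈ X)) ∈ charFun '' H := by
    rw [← IsClosed.closure_eq hcl, mem_closure_pi_iff]
    intro I
    refine ⟨charFun (I.filter (· ∈ X)), Set.mem_image_of_mem _ (h _ ?_), fun a ha => ?_⟩
    · exact fun a ha => (Finset.mem_filter.1 ha).2
    · simp [charFun, ha]
  obtain ⟨s, -, hs⟩ := hmem
  refine hX (s.finite_toSet.subset fun a ha => ?_)
  simpa [charFun, ha] using congrFun hs a

theorem exists_infColl_of_not_pointwiseClosed (hH : H ⊆ finColl)
    (hsub : ∀ s ∈ H, ∀ t ⊆ s, t ∈ H) (h : ¬ PointwiseClosed H) :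
    ∃ X ∈ infColl, ∀ Y : Finset (Finset ℕ+), (Y : Set (Finset ℕ+)) ⊆ X → Y ∈ H := by
  rw [PointwiseClosed, ← closure_subset_iff_isClosed, Set.not_subset] at h
  obtain ⟨f, hf, hfH⟩ := h
  rw [mem_closure_pi_iff] at hf
  have hfin : ∀ Y : Finset (Finset ℕ+), (∀ a ∈ Y, f a = true) → Y ∈ H := fun Y hY => by
    obtain ⟨_, ⟨s, hs, rfl⟩, hsY⟩ := hf Y
    exact hsub s hs Y fun a ha => of_decide_eq_true ((hsY a ha).trans (hY a ha))
  have hinf : {a | f a = true}.Infinite := fun hinf => by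
    refine hfH ⟨hinf.toFinset, hfin _ fun a ha => by simpa using ha, funext fun a => ?_⟩
    cases hfa : f a <;> simp [charFun, hfa]
  refine ⟨{a | f a = true}, ⟨hinf, fun a ha => ?_, fun a ha b hb hab => ?_⟩, hfin⟩
  · exact (hH (hfin {a} (by simpa using ha))).1 a (by simp)
  · exact (hH (hfin {a, b} (by simpa using ⟨ha, hb⟩))).2 (by simp) (by simp) hab

theorem IsHereditary.pointwiseClosed_iff (hH : IsHereditary H) :
    PointwiseClosed (H ∩ finCollIn D) ↔ ¬ ∃ X ∈ infCollIn D, finCollIn X ⊆ H := by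
  constructor
  · rintro hcl ⟨X, hX, h⟩
    refine not_pointwiseClosed (H := H ∩ finCollIn D) hX.1.1
      (fun Y hY => ⟨?_, hX.1.2.mono hY, hY.trans hX.2⟩) hcl
    exact (hH.finCollIn_subset_iff hX.1.2).1 h Y hY
  · refine fun h => by_contra fun hcl => h ?_
    obtain ⟨X, hX, hXH⟩ := exists_infColl_of_not_pointwiseClosed
      (H := H ∩ finCollIn D) (fun s hs => hs.2.1)
      (fun s hs t ht => ⟨hH.mem_of_subset hs.1 hs.2.1 ht, hs.2.1.mono (Finset.coe_subset.2 ht),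
        (Finset.coe_subset.2 ht).trans hs.2.2⟩) hcl
    refine ⟨X, ⟨hX, fun a ha => ?_⟩, (hH.finCollIn_subset_iff hX.2).2 fun Y hY => (hXH Y hY).1⟩
    exact (hXH {a} (by simpa using ha)).2.2 (by simp)

end PointwiseClosed

/-! ### Strong Cantor–Bendixson derivatives -/

section CantorBendixson

variable {D D₁ : Set (Finset ℕ+)} {G : Set (Finset (Finset ℕ+))} {s : Finset (Finset ℕ+)}
  {ξ η : Ordinal.{0}}

theorem mem_cbStep_iff (hD : D ∈ infColl) :
    s ∈ cbStep D G ↔ s ∈ G ∧ s ∈ finCollIn D ∧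
      ∃ a, ∀ t ∈ FU D, BlockLT a t → insert t s ∈ G := by
  have hins : ∀ t, s ∪ {t} = insert t s := fun t => by rw [Finset.union_comm, Finset.insert_eq]
  simp only [cbStep, hins, Set.mem_ofPred_eq, Set.mem_inter_iff, and_assoc]
  refine and_congr_right fun _ => and_congr_right fun _ => ⟨fun hE => ?_, ?_⟩
  · by_contra! hcon
    refine hE (exists_infColl_subset (fun t ht => nonempty_of_mem_FU hD.2.1 ht.1) fun a => ?_)
    obtain ⟨t, ht, hat, htG⟩ := hcon a
    exact ⟨t, ⟨ht, htG⟩, hat⟩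
  · rintro ⟨a, h⟩ ⟨E, hE, hsub⟩
    obtain ⟨t, ht, hat⟩ := exists_blockLT hE a
    exact (hsub ht).2 (h t (hsub ht).1 hat)

variable (D G) in
theorem cbDeriv_zero : cbDeriv D G 0 = G := Ordinal.limitRecOn_zero _ _ _

variable (D G) in
theorem cbDeriv_add_one (ξ : Ordinal.{0}) :
    cbDeriv D G (ξ + 1) = cbStep D (cbDeriv D G ξ) := Ordinal.limitRecOn_add_one _ _ _ _

theorem mem_cbDeriv_limit (hξ : Order.IsSuccLimit ξ) :
    s ∈ cbDeriv D G ξ ↔ ∀ β < ξ, s ∈ cbDeriv D G β := by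
  rw [cbDeriv, Ordinal.limitRecOn_limit _ _ _ _ hξ]
  simp only [Set.mem_iInter]
  rfl

variable (D G) in
theorem cbDeriv_antitone : Antitone (cbDeriv D G) := by
  intro η ξ h
  induction ξ using Ordinal.limitRecOn with
  | zero => rw [nonpos_iff_eq_zero.1 h]
  | add_one ζ ih =>
    rcases h.eq_or_lt with rfl | h
    · exact Set.Subset.rfl
    · rw [cbDeriv_add_one]
      exact fun s hs => ih (Order.lt_add_one_iff.1 h) hs.1.1
  | limit ξ hξ _ =>
    rcases h.eq_or_lt with rfl | h
    · exact Set.Subset.rfl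
    · exact fun s hs => (mem_cbDeriv_limit hξ).1 hs η h

theorem cbDeriv_subset (ξ : Ordinal.{0}) : cbDeriv D G ξ ⊆ G := by
  simpa only [cbDeriv_zero] using cbDeriv_antitone D G (zero_le (a := ξ))

theorem isHereditary_cbDeriv (hG : IsHereditary G) (hD : D ∈ infColl) (ξ : Ordinal.{0}) :
    IsHereditary (cbDeriv D G ξ) := by
  induction ξ using Ordinal.limitRecOn with
  | zero => rwa [cbDeriv_zero]
  | add_one ζ ih =>
    rw [cbDeriv_add_one]
    intro s hs t ht hts
    rw [mem_cbStep_iff hD] at hs ⊢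
    obtain ⟨hsζ, hsD, a, hins⟩ := hs
    refine ⟨ih s hsζ t ht hts, ⟨ht, hts.trans (FU_subset_FU hsD.2)⟩, a ∪ supp s,
      fun u hu hau => ?_⟩
    rw [blockLT_union] at hau
    refine ih _ (hins u hu hau.1) _ (insert_mem_finColl ht (nonempty_of_mem_FU hD.2.1 hu)
      (hau.2.mono (supp_subset_supp hts) Finset.Subset.rfl)) ?_
    rw [Finset.coe_insert, Finset.coe_insert]
    exact Set.insert_subset (subset_FU _ (Set.mem_insert _ _))
      (hts.trans (FU_mono (Set.subset_insert _ _)))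
  | limit ξ hξ ih =>
    intro s hs t ht hts
    rw [mem_cbDeriv_limit hξ] at hs ⊢
    exact fun β hβ => ih β hβ s (hs β hβ) t ht hts

theorem IsHereditary.empty_mem_cbDeriv (hG : IsHereditary G) (hD : D ∈ infColl)
    (h : (cbDeriv D G ξ).Nonempty) : ∅ ∈ cbDeriv D G ξ :=
  let ⟨s, hs⟩ := h
  isHereditary_cbDeriv hG hD ξ s hs ∅ empty_mem_finColl (by simp)

theorem mem_cbDeriv_of_mem (hD : D ∈ infColl) (hD₁ : D₁ ∈ infCollIn D)
    (hs : s ∈ cbDeriv D G ξ) (hsD : s ∈ finCollIn D₁) : s ∈ cbDeriv D₁ G ξ := by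
  induction ξ using Ordinal.limitRecOn generalizing s with
  | zero => rwa [cbDeriv_zero] at hs ⊢
  | add_one ζ ih =>
    rw [cbDeriv_add_one] at hs ⊢
    rw [mem_cbStep_iff hD] at hs
    rw [mem_cbStep_iff hD₁.1]
    obtain ⟨hsζ, -, a, hins⟩ := hs
    refine ⟨ih hsζ hsD, hsD, a ∪ supp s, fun t ht hat => ?_⟩
    rw [blockLT_union] at hat
    exact ih (hins t (FU_subset_FU hD₁.2 ht) hat.1) (insert_mem_finCollIn hD₁.1 hsD ht hat.2)
  | limit ξ hξ ih =>
    rw [mem_cbDeriv_limit hξ] at hs ⊢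
    exact fun β hβ => ih β hβ (hs β hβ) hsD

/-- `u` is an end-extension within `G` of the finite disjoint collection `s` on `D` by one further
element of `FU D`; the ranks of this relation control the derivatives of `G`. -/
def IsOneBlockExtension (D : Set (Finset ℕ+)) (G : Set (Finset (Finset ℕ+)))
    (u s : Finset (Finset ℕ+)) : Prop :=
  s ∈ finCollIn D ∧ ∃ t ∈ FU D, BlockLT (supp s) t ∧ u = insert t s ∧ u ∈ G

theorem IsHereditary.wellFounded_isOneBlockExtension (hG : IsHereditary G) (hD : D ∈ infColl)
    (hX : ¬ ∃ X ∈ infCollIn D, finCollIn X ⊆ G) : WellFounded (IsOneBlockExtension D G) := by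
  rw [wellFounded_iff_isEmpty_descending_chain]
  refine ⟨fun ⟨f, hf⟩ => hX ?_⟩
  have hfin : ∀ n, f n ∈ finCollIn D := fun n => (hf n).1
  choose _ t ht hlt hins hfG using hf
  have hmono : Monotone f := monotone_nat_of_le_succ fun n => by
    rw [hins n]; exact Finset.subset_insert _ _
  have htf : ∀ m n, m < n → t m ∈ f n := fun m n hmn =>
    hmono (Nat.succ_le_of_lt hmn) (by rw [Nat.succ_eq_add_one, hins m]; simp)
  have hrange : Set.range t ∈ infColl :=
    range_mem_infColl (fun n => nonempty_of_mem_FU hD.2.1 (ht n))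
      fun m n hmn => blockLT_supp.1 (hlt n) _ (htf m n hmn)
  refine ⟨Set.range t, ⟨hrange, Set.range_subset_iff.2 ht⟩,
    (hG.finCollIn_subset_iff hrange.2).2 fun Y hY => ?_⟩
  rw [← Set.image_univ] at hY
  obtain ⟨I, -, rfl⟩ := Finset.subset_set_image_iff.1 hY
  obtain ⟨N, hN⟩ := I.bddAbove
  refine hG.mem_of_subset (hfG N) (hfin _).1 fun a ha => ?_
  obtain ⟨i, hi, rfl⟩ := Finset.mem_image.1 ha
  exact htf i _ (Nat.lt_succ_of_le (hN hi))

theorem notMem_cbDeriv_add_one (hD₁ : D₁ ∈ infColl)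
    (h : ∀ t ∈ FU D₁, BlockLT (supp s) t → insert t s ∉ cbDeriv D₁ G ξ) :
    s ∉ cbDeriv D₁ G (ξ + 1) := by
  rw [cbDeriv_add_one, mem_cbStep_iff hD₁]
  rintro ⟨-, -, a, hins⟩
  obtain ⟨t, ht, hat⟩ := exists_blockLT hD₁ (a ∪ supp s)
  rw [blockLT_union] at hat
  exact h t (subset_FU _ ht) hat.2 (hins t (subset_FU _ ht) hat.1)

theorem exists_forall_notMem_cbDeriv (hD : D ∈ infColl)
    (hwf : WellFounded (IsOneBlockExtension D G)) (hs : s ∈ finCollIn D) :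
    ∃ ρ < ω_ 1, ∀ D₁ ∈ infCollIn D, s ∉ cbDeriv D₁ G ρ := by
  induction s using hwf.induction with
  | _ s ih =>
  have hbound : ∀ t : Finset ℕ+, ∃ ρ < ω_ 1, t ∈ FU D → BlockLT (supp s) t →
      ∀ D₁ ∈ infCollIn D, insert t s ∉ cbDeriv D₁ G ρ := by
    intro t
    by_cases ht : t ∈ FU D ∧ BlockLT (supp s) t ∧ insert t s ∈ G
    · obtain ⟨ρ, hρ, h⟩ := ih _ ⟨hs, t, ht.1, ht.2.1, rfl, ht.2.2⟩
        (insert_mem_finCollIn hD hs ht.1 ht.2.1)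
      exact ⟨ρ, hρ, fun _ _ => h⟩
    · exact ⟨0, Ordinal.omega_pos 1, fun htD hst _ _ hmem =>
        ht ⟨htD, hst, cbDeriv_subset _ hmem⟩⟩
  choose ρ hρ h using hbound
  refine ⟨(⨆ t, ρ t) + 1, Ordinal.isPrincipal_add_omega 1 (Ordinal.iSup_lt_omega_one hρ)
    (Ordinal.one_lt_omega0.trans Ordinal.omega0_lt_omega_one), fun D₁ hD₁ => ?_⟩
  refine notMem_cbDeriv_add_one hD₁.1 fun t ht hst hmem => ?_
  exact h t (FU_subset_FU hD₁.2 ht) hst D₁ hD₁ (cbDeriv_antitone D₁ G (Ordinal.le_iSup ρ t) hmem)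

theorem IsHereditary.exists_cbDeriv_eq_empty (hG : IsHereditary G) (hD : D ∈ infColl)
    (hX : ¬ ∃ X ∈ infCollIn D, finCollIn X ⊆ G) :
    ∃ ρ < ω_ 1, ∀ D₁ ∈ infCollIn D, cbDeriv D₁ G ρ = ∅ := by
  obtain ⟨ρ, hρ, h⟩ := exists_forall_notMem_cbDeriv hD (hG.wellFounded_isOneBlockExtension hD hX)
    (empty_mem_finCollIn D)
  refine ⟨ρ, hρ, fun D₁ hD₁ => ?_⟩
  rw [← Set.not_nonempty_iff_eq_empty]
  exact fun hne => h D₁ hD₁ (hG.empty_mem_cbDeriv hD₁.1 hne)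

theorem lt_cbIndex_iff (h : ∃ ρ < ω_ 1, cbDeriv D G ρ = ∅) :
    ξ < cbIndex D G ↔ (cbDeriv D G ξ).Nonempty := by
  have hmem := csInf_mem (s := {ξ | ξ < ω_ 1 ∧ cbDeriv D G ξ = ∅}) h
  constructor
  · intro hlt
    rw [Set.nonempty_iff_ne_empty]
    exact fun h0 => hlt.not_ge (csInf_le' ⟨hlt.trans hmem.1, h0⟩)
  · intro hne
    by_contra hle
    exact (hne.mono (cbDeriv_antitone D G (not_lt.1 hle))).ne_empty hmem.2

theorem cbIndex_le (hξ : ξ < ω_ 1) (h : cbDeriv D G ξ = ∅) : cbIndex D G ≤ ξ :=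
  csInf_le' ⟨hξ, h⟩

section Bounded

variable (hb : ∃ ρ < ω_ 1, ∀ D₁ ∈ infCollIn D, cbDeriv D₁ G ρ = ∅)
include hb

theorem cbSup_lt_omega_one (hD : D ∈ infColl) : cbSup D G < ω_ 1 := by
  obtain ⟨ρ, hρ, h⟩ := hb
  suffices hle : cbSup D G ≤ ρ from hle.trans_lt hρ
  refine csSup_le ⟨_, D, infCollIn_self hD, rfl⟩ ?_
  rintro _ ⟨D₁, hD₁, rfl⟩
  exact cbIndex_le hρ (h D₁ hD₁)

theorem lt_cbSup_iff (hD : D ∈ infColl) :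
    ξ < cbSup D G ↔ ∃ D₁ ∈ infCollIn D, (cbDeriv D₁ G ξ).Nonempty := by
  obtain ⟨ρ, hρ, h⟩ := hb
  have hbdd : BddAbove {η | ∃ D₁ ∈ infCollIn D, η = cbIndex D₁ G} := by
    refine ⟨ρ, ?_⟩
    rintro _ ⟨D₁, hD₁, rfl⟩
    exact cbIndex_le hρ (h D₁ hD₁)
  rw [cbSup, lt_csSup_iff hbdd ⟨_, D, infCollIn_self hD, rfl⟩]
  constructor
  · rintro ⟨_, ⟨D₁, hD₁, rfl⟩, hlt⟩
    exact ⟨D₁, hD₁, (lt_cbIndex_iff ⟨ρ, hρ, h D₁ hD₁⟩).1 hlt⟩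
  · rintro ⟨D₁, hD₁, hne⟩
    exact ⟨_, ⟨D₁, hD₁, rfl⟩, (lt_cbIndex_iff ⟨ρ, hρ, h D₁ hD₁⟩).2 hne⟩

end Bounded

end CantorBendixson

/-! ### Derivatives against the thin families -/

section Comparison

variable {D : Set (Finset ℕ+)} {F G : Set (Finset (Finset ℕ+))} {s : Finset (Finset ℕ+)}
  {ξ η ρ : Ordinal.{0}}

theorem exists_reach_of_thinFamily_subset_compl
    (hno : thinFamily lam ξ ∩ finCollIn D ⊆ Gᶜ) (hs : s ∈ finCollIn D)
    (hinit : ∀ t ∈ finColl, IsInitial t s → t ∈ G) : ∃ ρ, ρ ≠ 0 ∧ Reach lam ξ (mins s) ρ := by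
  refine (reach_or_exists_isInitial lam ξ hs.1).resolve_right ?_
  rintro ⟨t, ht, hts⟩
  exact hno ⟨ht, hts.mem_finCollIn hs⟩ (hinit t ht.1 hts)

/-- On `D`, the derivatives of `G` decrease at least as fast as those of the initial segments of
`𝓑^ξ`, whose ranks are the endpoints of the walks from `ξ`. -/
theorem IsHereditary.add_le_of_mem_cbDeriv (hG : IsHereditary G) (hD : D ∈ infColl)
    (hno : thinFamily lam ξ ∩ finCollIn D ⊆ Gᶜ) (hs : s ∈ cbDeriv D G η)
    (hsD : s ∈ finCollIn D) : ∃ ρ, Reach lam ξ (mins s) ρ ∧ 1 + η ≤ ρ := by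
  have hreach : ∀ {s η}, s ∈ cbDeriv D G η → s ∈ finCollIn D →
      ∃ ρ, ρ ≠ 0 ∧ Reach lam ξ (mins s) ρ := fun hs hsD =>
    exists_reach_of_thinFamily_subset_compl hno hsD fun _ _ ht =>
      hG.mem_of_subset (cbDeriv_subset _ hs) hsD.1 ht.1
  induction η using Ordinal.limitRecOn generalizing s with
  | zero =>
    obtain ⟨ρ, hρ, h⟩ := hreach hs hsD
    exact ⟨ρ, h, by simpa using Order.one_le_iff_pos.2 (pos_iff_ne_zero.2 hρ)⟩
  | add_one ζ ih =>
    rw [cbDeriv_add_one, mem_cbStep_iff hD] at hs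
    obtain ⟨hsζ, -, a, hins⟩ := hs
    obtain ⟨ρ, hρ, h⟩ := hreach hsζ hsD
    obtain ⟨t, ht, hat⟩ := exists_blockLT hD (a ∪ supp s)
    rw [blockLT_union] at hat
    have htFU := subset_FU D ht
    obtain ⟨σ, hσ, hle⟩ := ih (hins t htFU hat.1) (insert_mem_finCollIn hD hsD htFU hat.2)
    rw [hσ.unique (h.insert_block hρ hsD.1 (hD.2.1 t ht) hat.2)] at hle
    refine ⟨ρ, h, ?_⟩
    rw [← add_assoc, Order.add_one_le_iff]
    exact hle.trans_lt (fundSeq_lt hρ _)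
  | limit η hη ih =>
    have hs' := (mem_cbDeriv_limit hη).1 hs
    obtain ⟨ρ, -, h⟩ := hreach hs hsD
    refine ⟨ρ, h, (Ordinal.add_le_iff_of_isSuccLimit hη).2 fun β hβ => ?_⟩
    obtain ⟨σ, hσ, hle⟩ := ih β hβ (hs' β hβ) hsD
    rwa [hσ.unique h] at hle

theorem IsHereditary.mem_cbDeriv_of_reach (hlam : IsFundamentalSystem lam)
    (hG : IsHereditary G) (hD : D ∈ infColl) (hξ : ξ < ω_ 1)
    (hall : thinFamily lam ξ ∩ finCollIn D ⊆ G) (h : Reach lam ξ (mins s) ρ) (hηρ : η ≤ ρ)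
    (hsD : s ∈ finCollIn D) : s ∈ cbDeriv D G η := by
  induction η using Ordinal.limitRecOn generalizing s ρ with
  | zero =>
    rw [cbDeriv_zero]
    obtain ⟨u, hu, hsu⟩ := h.exists_extension hD hsD
    exact hG.mem_of_subset (hall hu) hu.1.1 hsu.1
  | add_one ζ ih =>
    rw [cbDeriv_add_one, mem_cbStep_iff hD]
    have hlt : ζ < ρ := Order.add_one_le_iff.1 hηρ
    obtain ⟨N, hN⟩ := Filter.eventually_atTop.1
      (eventually_le_fundSeq hlam (h.le.trans_lt hξ) hlt)
    refine ⟨ih h hlt.le hsD, hsD, {N} ∪ supp s, fun t ht hat => ?_⟩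
    rw [blockLT_union] at hat
    have htne := nonempty_of_mem_FU hD.2.1 ht
    refine ih (h.insert_block (pos_of_gt hlt).ne' hsD.1 htne hat.2) (hN _ ?_)
      (insert_mem_finCollIn hD hsD ht hat.2)
    exact (hat.1 N (Finset.mem_singleton_self N) _ (isLeast_minOf htne).1).le
  | limit η hη ih =>
    rw [mem_cbDeriv_limit hη]
    exact fun β hβ => ih β hβ h (hβ.le.trans hηρ) hsD

theorem IsHereditary.exists_thinFamily_subset (hG : IsHereditary G) (hD : D ∈ infColl)
    (hne : (cbDeriv D G η).Nonempty) (hξη : ξ < 1 + η) :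
    ∃ D₂ ∈ infCollIn D, thinFamily lam ξ ∩ finCollIn D₂ ⊆ G := by
  obtain ⟨D₂, hD₂, hall | hno⟩ := exists_homogeneous lam ξ G hD
  · exact ⟨D₂, hD₂, hall⟩
  · have hmem := mem_cbDeriv_of_mem hD hD₂ (hG.empty_mem_cbDeriv hD hne) (empty_mem_finCollIn D₂)
    obtain ⟨σ, hσ, hle⟩ := hG.add_le_of_mem_cbDeriv hD₂.1 hno hmem (empty_mem_finCollIn D₂)
    rw [hσ.of_empty] at hle
    exact absurd hle hξη.not_ge

theorem IsTree.thinFamily_inter_hereditaryPart_nonempty (hT : IsTree F) (hD : D ∈ infColl)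
    (hall : thinFamily lam ξ ∩ finCollIn D ⊆ F) :
    (thinFamily lam ξ ∩ finCollIn D ∩ hereditaryPart F).Nonempty := by
  have hne : (thinFamily lam ξ ∩ finCollIn D).Nonempty :=
    let ⟨u, hu, _⟩ := Reach.exists_extension (lam := lam) (ξ := ξ) hD (s := ∅) Reach.nil
      (empty_mem_finCollIn D)
    ⟨u, hu⟩
  -- A collection of unions of members of a shortest `s` is no longer than `s`, so it cannot
  -- properly extend a member of the family.
  obtain ⟨s, ⟨hsξ, hsD⟩, hmin⟩ := exists_minimalFor_of_wellFoundedLT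
    (· ∈ thinFamily lam ξ ∩ finCollIn D) Finset.card hne
  refine ⟨s, ⟨hsξ, hsD⟩, Or.inl ⟨hall ⟨hsξ, hsD⟩, fun t ht hts => ?_⟩⟩
  have htD : t ∈ finCollIn D := ⟨ht, hts.trans (FU_subset_FU hsD.2)⟩
  rcases reach_or_exists_isInitial lam ξ ht with ⟨ρ, -, h⟩ | ⟨u, hu, hut⟩
  · obtain ⟨v, hv, htv⟩ := h.exists_extension hD htD
    exact hT.mem_of_isInitial (hall hv) ht htv
  · have huD : u ∈ thinFamily lam ξ ∩ finCollIn D := ⟨hu, hut.mem_finCollIn htD⟩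
    have hcard : t.card ≤ u.card := (card_le_card_of_subset_FU hsD.1 ht hts).trans
      ((le_total s.card u.card).elim id (hmin huD))
    exact Finset.eq_of_subset_of_card_le hut.1 hcard ▸ hall huD

theorem IsTree.exists_thinFamily_subset_hereditaryPart (hT : IsTree F) (hD : D ∈ infColl)
    (hall : thinFamily lam ξ ∩ finCollIn D ⊆ F) :
    ∃ D₁ ∈ infCollIn D, thinFamily lam ξ ∩ finCollIn D₁ ⊆ hereditaryPart F := by
  obtain ⟨D₁, hD₁, h | hno⟩ := exists_homogeneous lam ξ (hereditaryPart F) hD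
  · exact ⟨D₁, hD₁, h⟩
  · obtain ⟨s, hs, hsF⟩ := hT.thinFamily_inter_hereditaryPart_nonempty hD₁.1
      ((Set.inter_subset_inter_right _ (finCollIn_mono hD₁.2)).trans hall)
    exact absurd hsF (hno hs)

theorem IsTree.inter_subset_initialClosure_sdiff (hT : IsTree F) (hD : D ∈ infColl)
    (hno : thinFamily lam ξ ∩ finCollIn D ⊆ Fᶜ) :
    F ∩ finCollIn D ⊆ initialClosure (thinFamily lam ξ) \ thinFamily lam ξ := by
  rintro s ⟨hsF, hsD⟩
  refine ⟨?_, fun hs => hno ⟨hs, hsD⟩ hsF⟩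
  obtain ⟨ρ, -, h⟩ := exists_reach_of_thinFamily_subset_compl hno hsD
    fun t ht hts => hT.mem_of_isInitial hsF ht hts
  obtain ⟨u, hu, hsu⟩ := h.exists_extension hD hsD
  exact Or.inl ⟨hsD.1, u, hu.1, hsu⟩

theorem IsTree.exists_thinFamily_subset_compl (hlam : IsFundamentalSystem lam) (hT : IsTree F)
    (hD : D ∈ infColl) (hξ : ξ < ω_ 1)
    (hempty : ∀ D₁ ∈ infCollIn D, cbDeriv D₁ (hereditaryPart F) ξ = ∅) :
    ∃ D₁ ∈ infCollIn D, thinFamily lam ξ ∩ finCollIn D₁ ⊆ Fᶜ := by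
  obtain ⟨D₁, hD₁, hall | hno⟩ := exists_homogeneous lam ξ F hD
  · obtain ⟨D₂, hD₂, hall₂⟩ := hT.exists_thinFamily_subset_hereditaryPart hD₁.1 hall
    have hmem : ∅ ∈ cbDeriv D₂ (hereditaryPart F) ξ :=
      (isHereditary_hereditaryPart F).mem_cbDeriv_of_reach hlam hD₂.1 hξ hall₂ Reach.nil le_rfl
        (empty_mem_finCollIn D₂)
    rw [hempty D₂ (infCollIn_trans hD₁ hD₂)] at hmem
    exact hmem.elim
  · exact ⟨D₁, hD₁, hno⟩

end Comparison

end BlockSchreier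

open BlockSchreier in
theorem theorem3p3_general (lam : Ordinal.{0} → ℕ+ → Ordinal.{0}) (hlam : IsFundamentalSystem lam)
    (F : Set (Finset (Finset ℕ+))) (hT : IsTree F)
    (D : Set (Finset ℕ+)) (hD : D ∈ infColl) :
    (¬ PointwiseClosed (hereditaryPart F ∩ finCollIn D) →
      ∃ D₁ ∈ infCollIn D, finCollIn D₁ ⊆ F) ∧
    (PointwiseClosed (hereditaryPart F ∩ finCollIn D) →
      (∀ D₁ ∈ infCollIn D, ∃ η < ω_ 1, cbDeriv D₁ (hereditaryPart F) η = ∅) ∧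
      cbSup D (hereditaryPart F) < ω_ 1 ∧
      ∀ ξ : Ordinal.{0}, ξ < ω_ 1 →
        (ξ + 1 < 1 + cbSup D (hereditaryPart F) →
          ∃ D₂ ∈ infCollIn D, blockSchreier lam ξ ∩ finCollIn D₂ ⊆ F) ∧
        (cbSup D (hereditaryPart F) ≤ ξ →
          ∀ D₁ ∈ infCollIn D, ∃ D₂ ∈ infCollIn D₁,
            blockSchreier lam ξ ∩ finCollIn D₂ ⊆ finColl \ F ∧
            F ∩ finCollIn D₂ ⊆ initialClosure (blockSchreier lam ξ) \ blockSchreier lam ξ)) ∧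
    ∀ ξ : Ordinal.{0}, ξ < ω_ 1 →
      ∃ D₂ ∈ infCollIn D,
        blockSchreier lam ξ ∩ finCollIn D₂ ⊆ F ∨
        blockSchreier lam ξ ∩ finCollIn D₂ ⊆ finColl \ F := by
  have hH := isHereditary_hereditaryPart F
  have hHF := hereditaryPart_subset hT.empty_mem
  have hcompl : ∀ {B : Set (Finset (Finset ℕ+))} {D}, B ∩ finCollIn D ⊆ Fᶜ →
      B ∩ finCollIn D ⊆ finColl \ F := fun h s hs => ⟨hs.2.1, h hs⟩
  rw [hH.pointwiseClosed_iff, not_not]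
  refine ⟨fun ⟨X, hX, hXH⟩ => ⟨X, hX, hXH.trans hHF⟩, fun hX => ?_, fun ξ hξ => ?_⟩
  · have hb := hH.exists_cbDeriv_eq_empty hD hX
    refine ⟨fun D₁ hD₁ => hb.imp fun ρ h => ⟨h.1, h.2 D₁ hD₁⟩, cbSup_lt_omega_one hb hD,
      fun ξ hξ => ?_⟩
    rw [blockSchreier_eq_thinFamily hlam hξ]
    refine ⟨fun hlt => ?_, fun hle D₁ hD₁ => ?_⟩
    · have hne : cbSup D (hereditaryPart F) ≠ 0 := fun h0 => by
        rw [h0, add_zero] at hlt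
        exact hlt.not_ge le_add_self
      obtain ⟨η, hη, hξη⟩ := (Ordinal.lt_add_iff hne).1 hlt
      obtain ⟨D₁, hD₁, hne⟩ := (lt_cbSup_iff hb hD).1 hη
      obtain ⟨D₂, hD₂, h⟩ := hH.exists_thinFamily_subset (lam := lam) hD₁.1 hne
        (Order.add_one_le_iff.1 hξη)
      exact ⟨D₂, infCollIn_trans hD₁ hD₂, h.trans hHF⟩
    · have hempty : ∀ D₂ ∈ infCollIn D, cbDeriv D₂ (hereditaryPart F) ξ = ∅ := by
        simpa [lt_cbSup_iff hb hD, Set.not_nonempty_iff_eq_empty] using hle.not_gt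
      obtain ⟨D₂, hD₂, h⟩ := hT.exists_thinFamily_subset_compl hlam hD₁.1 hξ
        fun D₂ hD₂ => hempty D₂ (infCollIn_trans hD₁ hD₂)
      exact ⟨D₂, hD₂, hcompl h, hT.inter_subset_initialClosure_sdiff hD₂.1 h⟩
  · rw [blockSchreier_eq_thinFamily hlam hξ]
    obtain ⟨D₂, hD₂, h⟩ := exists_homogeneous lam ξ F hD
    exact ⟨D₂, hD₂, h.imp_right hcompl⟩

open BlockSchreier in
theorem theorem3p3 (lam : Ordinal.{0} → ℕ+ → Ordinal.{0}) (hlam : IsFundamentalSystem lam)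
    (F : Set (Finset (Finset ℕ+))) (hF : F ⊆ finColl) (hT : IsTree F)
    (D : Set (Finset ℕ+)) (hD : D ∈ infColl) :
    (¬ PointwiseClosed (hereditaryPart F ∩ finCollIn D) →
      ∃ D₁ ∈ infCollIn D, finCollIn D₁ ⊆ F) ∧
    (PointwiseClosed (hereditaryPart F ∩ finCollIn D) →
      -- all the indices are well defined, and their supremum is a countable ordinal
      (∀ D₁ ∈ infCollIn D, ∃ η < ω_ 1, cbDeriv D₁ (hereditaryPart F) η = ∅) ∧
      cbSup D (hereditaryPart F) < ω_ 1 ∧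
      ∀ ξ : Ordinal.{0}, ξ < ω_ 1 →
        (ξ + 1 < cbSup D (hereditaryPart F) →
          ∃ D₂ ∈ infCollIn D, blockSchreier lam ξ ∩ finCollIn D₂ ⊆ F) ∧
        (cbSup D (hereditaryPart F) < ξ →
          ∀ D₁ ∈ infCollIn D, ∃ D₂ ∈ infCollIn D₁,
            blockSchreier lam ξ ∩ finCollIn D₂ ⊆ finColl \ F ∧
            F ∩ finCollIn D₂ ⊆ initialClosure (blockSchreier lam ξ) \ blockSchreier lam ξ) ∧
        (ξ + 1 = cbSup D (hereditaryPart F) ∨ ξ = cbSup D (hereditaryPart F) →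
          ∃ D₂ ∈ infCollIn D,
            blockSchreier lam ξ ∩ finCollIn D₂ ⊆ F ∨
            blockSchreier lam ξ ∩ finCollIn D₂ ⊆ finColl \ F)) := by
  obtain ⟨hnot, h_closed, h_dichotomy⟩ := theorem3p3_general lam hlam F hT D hD
  refine ⟨hnot, fun h => ?_⟩
  obtain ⟨hindex, hsup, hξ⟩ := h_closed h
  exact ⟨hindex, hsup, fun ξ hξ₁ => ⟨fun hlt => (hξ ξ hξ₁).1 (hlt.trans_le le_add_self),
    fun hlt => (hξ ξ hξ₁).2 hlt.le, fun _ => h_dichotomy ξ hξ₁⟩⟩
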